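/- Let $\mu\in\{1,-1,0\}$ and $T>0$, and consider the Cauchy problem $$u_t+\bigl(u(uu_x)_x+\mu u^3\bigr)_x=0,\qquad u(0)=u_0,\tag{1}$$ on $[0,T]\times\mathbb R$. A non-negative function $u\in C^1([0,T]\times\mathbb R)$ is called a hydrodynamic solution of (1) if $u(0,\cdot)=u_0$, $u^2\in C([0,T];C^3(\mathbb R))$ and, for all $(t,x)\in[0,T]\times\mathbb R$, $$u_t+(bu)_x=0,\qquad b=\tfrac12(u^2)_{xx}+\mu u^2 .$$ Write $C_b^k(\mathbb R)=C^k(\mathbb R)\cap W^{k,\infty}(\mathbb R)$, with the $W^{k,\infty}$ norm. **Theorem.** Let $u_0\in C_b^1(\mathbb R)$ be non-negative, with $u_0^2\in C_b^3(\mathbb R)$ and $u_0^{4/3}\in C_b^2(\mathbb R)$. Then there is at most one hydrodynamic solution $u$ of (1) on $[0,T]$ such that $u^2\in C([0,T];C_b^3(\mathbb R))$ and $u^{4/3}\in C([0,T];C_b^2(\mathbb R))$. -/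

import Mathlib

open Set Filter Topology

/-- The space `C_b^k(ℝ) = C^k(ℝ) ∩ W^{k,∞}(ℝ)`: functions of class `C^k` whose derivatives
of order `0, …, k` are all bounded. -/
def MemCb (k : ℕ) (f : ℝ → ℝ) : Prop :=
  ContDiff ℝ k f ∧ ∀ j ≤ k, ∃ C : ℝ, ∀ x, |iteratedDeriv j f x| ≤ C

/-- `f ∈ C([0,T]; C^k(ℝ))`, where `C^k(ℝ)` has its usual topology (locally uniform convergence of
the derivatives of order `0, …, k`).  Only the values `f t` with `t ∈ [0,T]` matter. -/
def ContInTimeC (T : ℝ) (k : ℕ) (f : ℝ → ℝ → ℝ) : Prop :=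
  (∀ t ∈ Icc 0 T, ContDiff ℝ k (f t)) ∧
    ∀ t₀ ∈ Icc 0 T, ∀ j ≤ k,
      TendstoLocallyUniformly (fun t => iteratedDeriv j (f t)) (iteratedDeriv j (f t₀))
        (𝓝[Icc 0 T] t₀)

/-- `f ∈ C([0,T]; C_b^k(ℝ))`, where `C_b^k(ℝ)` has the `W^{k,∞}` norm, that is, the topology of
uniform convergence on `ℝ` of the derivatives of order `0, …, k`. -/
def ContInTimeCb (T : ℝ) (k : ℕ) (f : ℝ → ℝ → ℝ) : Prop :=
  (∀ t ∈ Icc 0 T, MemCb k (f t)) ∧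
    ∀ t₀ ∈ Icc 0 T, ∀ j ≤ k,
      TendstoUniformly (fun t => iteratedDeriv j (f t)) (iteratedDeriv j (f t₀))
        (𝓝[Icc 0 T] t₀)

/-- The velocity `b = (1/2) (u²)_xx + μ u²`. -/
noncomputable def velocity (μ : ℝ) (u : ℝ → ℝ → ℝ) (t x : ℝ) : ℝ :=
  1 / 2 * iteratedDeriv 2 (fun y => u t y ^ 2) x + μ * u t x ^ 2

/-- `u` is a hydrodynamic solution, on the time interval `[0,T]` and with initial data `u₀`, of
`u_t + (u (u u_x)_x + μ u³)_x = 0`.  The time derivative is one-sided at `t = 0` and `t = T`;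
all derivatives in the equation exist by the regularity conditions (for `0 < T`). -/
structure IsHydrodynamicSolution (μ T : ℝ) (u₀ : ℝ → ℝ) (u : ℝ → ℝ → ℝ) : Prop where
  nonneg : ∀ t ∈ Icc 0 T, ∀ x, 0 ≤ u t x
  contDiffOn : ContDiffOn ℝ 1 (fun p : ℝ × ℝ => u p.1 p.2) (Icc 0 T ×ˢ univ)
  sq_regular : ContInTimeC T 3 (fun t x => u t x ^ 2)
  equation : ∀ t ∈ Icc 0 T, ∀ x,
    derivWithin (fun s => u s x) (Icc 0 T) t + deriv (fun y => velocity μ u t y * u t y) x = 0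
  initial : ∀ x, u 0 x = u₀ x

/-! The proof is an energy estimate in Lagrangian mass coordinates. Along the flow X of b one has
u(t, X) = u₀ exp(-∫ b_x) and ∂_z X = u₀ / u(t, X). Hence u₀⁻¹ ∂_z corresponds to u⁻¹ ∂_x for each
solution, and two solutions with the same data can be compared label by label
(`exists_lagrangianSolution`).

Put S = u^(1/6) along the flow, f = S⁵, and let primes be mass derivatives. Then f_t + f⁶ f''' + 9
f⁵ f' f'' + (182/25) f⁴ f'³ + 2μ S¹⁸ f' = 0. The power 5/6 is chosen for the coefficient 9. For a
difference ω = f - g, integrating ω f⁶ ω''' by parts leaves (3/2)(f⁶)' ω'² = 9 f⁵ f' ω'², and the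
term 9 f⁵ f' ω ω'' cancels exactly this. Apart from derivatives of the weight, the energy production
is thus a total derivative plus a coefficient times ω² (`hasDerivAt_flux`).

The coefficient must stay bounded near vacuum. Since S⁸ = u^(4/3) is nonnegative with bounded second
derivative and S¹² = u² has bounded third derivative, each x-derivative of S costs a factor S⁻⁴. A
mass derivative then costs S⁻¹⁰, so f, f', f'', f''' have orders 5, -5, -15, -25 in S. Counting
powers shows the coefficient to be O(1). Along the flow S is comparable to u₀^(1/6), so both
solutions share one scale.

Two boundaries remain. At vacuum the flux is O(u₀), and u₀ has zero derivative at its zeros, so the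
flux extended by zero is differentiable on the whole line (`exists_flux`). At infinity a weight φ is
used with |φ'|, |φ''| ≤ 10 ε φ and ∫ φ = π/ε. The errors ε |ω| φ are at most a multiple of (ω² + ε²)
φ, so Gronwall bounds the energy by O(ε) (`exists_energy_le`), and ε → 0 gives equality of the two
functions S. Their mass derivatives, hence the velocities and flow maps over u₀ > 0, then agree as
well, which yields u = v. -/

theorem eq_of_hasDerivAt_zero {T : ℝ} {f : ℝ → ℝ} (hc : ContinuousOn f (Icc 0 T))
    (hd : ∀ t ∈ Ioo 0 T, HasDerivAt f 0 t) {t : ℝ} (ht : t ∈ Icc 0 T) : f t = f 0 := by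
  rcases ht.1.eq_or_lt with h | h
  · rw [← h]
  · obtain ⟨c, hc', h2⟩ := exists_hasDerivAt_eq_slope f (fun _ => 0) h
      (hc.mono (Icc_subset_Icc_right ht.2)) (fun x hx => hd x ⟨hx.1, hx.2.trans_le ht.2⟩)
    have h3 : t - 0 ≠ 0 := by linarith
    field_simp at h2
    linarith

/-! ### Bounds and joint continuity for curves in `C_b^k` -/

/-- The nearest point of `[0,T]`. -/
noncomputable def clampTime (T t : ℝ) : ℝ := max 0 (min t T)

theorem continuous_clampTime (T : ℝ) : Continuous (clampTime T) := by
  unfold clampTime; fun_prop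

theorem clampTime_mem {T : ℝ} (hT : 0 ≤ T) (t : ℝ) : clampTime T t ∈ Icc 0 T :=
  ⟨le_max_left _ _, max_le hT (min_le_right _ _)⟩

theorem clampTime_of_mem {T t : ℝ} (ht : t ∈ Icc 0 T) : clampTime T t = t := by
  simp [clampTime, ht.1, ht.2]

theorem ContInTimeCb.exists_bound {T : ℝ} {k : ℕ} {f : ℝ → ℝ → ℝ} (h : ContInTimeCb T k f)
    {j : ℕ} (hj : j ≤ k) :
    ∃ C : ℝ, ∀ t ∈ Icc 0 T, ∀ x, |iteratedDeriv j (f t) x| ≤ C := by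
  have hloc : ∀ t₀ ∈ Icc 0 T, ∃ s ∈ 𝓝[Icc 0 T] t₀, ∃ C : ℝ, ∀ t ∈ s, ∀ x,
      |iteratedDeriv j (f t) x| ≤ C := by
    intro t₀ ht₀
    obtain ⟨C, hC⟩ := (h.1 t₀ ht₀).2 j hj
    have := Metric.tendstoUniformly_iff.1 (h.2 t₀ ht₀ j hj) 1 one_pos
    refine ⟨_, this, C + 1, fun t ht x => ?_⟩
    have h1 := ht x
    rw [Real.dist_eq] at h1
    have h2 := hC x
    rw [abs_lt] at h1
    rw [abs_le] at h2 ⊢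
    constructor <;> linarith
  refine isCompact_Icc.induction_on (p := fun s => ∃ C : ℝ, ∀ t ∈ s, ∀ x,
      |iteratedDeriv j (f t) x| ≤ C) ⟨0, by simp⟩ ?_ ?_ hloc
  · rintro s t hst ⟨C, hC⟩
    exact ⟨C, fun a ha => hC a (hst ha)⟩
  · rintro s t ⟨C, hC⟩ ⟨D, hD⟩
    refine ⟨max C D, ?_⟩
    rintro a (ha | ha) x
    · exact (hC a ha x).trans (le_max_left _ _)
    · exact (hD a ha x).trans (le_max_right _ _)

theorem ContInTimeCb.continuousOn {T : ℝ} {k : ℕ} {f : ℝ → ℝ → ℝ} (h : ContInTimeCb T k f)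
    {j : ℕ} (hj : j ≤ k) :
    ContinuousOn (fun p : ℝ × ℝ => iteratedDeriv j (f p.1) p.2) (Icc 0 T ×ˢ univ) := by
  rintro ⟨t₀, x₀⟩ ⟨ht₀, -⟩
  have hc : Continuous (iteratedDeriv j (f t₀)) :=
    (h.1 t₀ ht₀).1.continuous_iteratedDeriv j (by exact_mod_cast hj)
  rw [ContinuousWithinAt, nhdsWithin_prod_eq, nhdsWithin_univ, Metric.tendsto_nhds]
  intro ε hε
  have h1 := Metric.tendstoUniformly_iff.1 (h.2 t₀ ht₀ j hj) (ε / 2) (half_pos hε)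
  have h2 := Metric.tendsto_nhds.1 (hc.tendsto x₀) (ε / 2) (half_pos hε)
  filter_upwards [h1.prod_mk h2] with p hp
  have h3 := hp.1 p.2
  rw [dist_comm] at h3
  calc _ ≤ _ := dist_triangle _ (iteratedDeriv j (f t₀) p.2) _
    _ < ε := by linarith [hp.2]

/-- Freezing time outside `[0,T]` gives coefficients continuous on the whole plane, so that flows
and time integrals need no one-sided treatment. -/
theorem ContInTimeCb.continuous_clampTime {T : ℝ} (hT : 0 ≤ T) {k : ℕ} {f : ℝ → ℝ → ℝ}
    (h : ContInTimeCb T k f) {j : ℕ} (hj : j ≤ k) :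
    Continuous (fun p : ℝ × ℝ => iteratedDeriv j (f (clampTime T p.1)) p.2) := by
  refine (h.continuousOn hj).comp_continuous (f := fun p : ℝ × ℝ => (clampTime T p.1, p.2)) ?_ ?_
  · exact ((_root_.continuous_clampTime T).comp continuous_fst).prodMk continuous_snd
  · exact fun p => ⟨clampTime_mem hT _, mem_univ _⟩

theorem ContInTimeCb.hasDerivAt {T : ℝ} {k : ℕ} {f : ℝ → ℝ → ℝ} (h : ContInTimeCb T k f)
    {j : ℕ} (hj : j < k) {t : ℝ} (ht : t ∈ Icc 0 T) (x : ℝ) :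
    HasDerivAt (iteratedDeriv j (f t)) (iteratedDeriv (j + 1) (f t) x) x := by
  rw [iteratedDeriv_succ]
  exact (((h.1 t ht).1.differentiable_iteratedDeriv j (by exact_mod_cast hj)) x).hasDerivAt
-- The flow of a velocity field and its spatial derivative
/-- The mean of `B' t` over the segment from `x` to `y`. -/
noncomputable def segmentMean (B' : ℝ → ℝ → ℝ) (t x y : ℝ) : ℝ :=
  ∫ θ in (0 : ℝ)..1, B' t (x + θ * (y - x))

theorem segmentMean_self (B' : ℝ → ℝ → ℝ) (t x : ℝ) : segmentMean B' t x x = B' t x := by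
  simp [segmentMean]

theorem continuous_segmentMean {B' : ℝ → ℝ → ℝ} (hB' : Continuous (fun p : ℝ × ℝ => B' p.1 p.2)) :
    Continuous (fun p : ℝ × ℝ × ℝ => segmentMean B' p.1 p.2.1 p.2.2) := by
  unfold segmentMean
  refine intervalIntegral.continuous_parametric_intervalIntegral_of_continuous' ?_ 0 1
  exact hB'.comp (f := fun q : (ℝ × ℝ × ℝ) × ℝ =>
    (q.1.1, q.1.2.1 + q.2 * (q.1.2.2 - q.1.2.1))) (by fun_prop)

theorem sub_eq_mul_segmentMean {B B' : ℝ → ℝ → ℝ}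
    (hB' : Continuous (fun p : ℝ × ℝ => B' p.1 p.2))
    (hd : ∀ t x, HasDerivAt (B t) (B' t x) x) (t x y : ℝ) :
    B t y - B t x = (y - x) * segmentMean B' t x y := by
  have hc : Continuous fun θ : ℝ => B' t (x + θ * (y - x)) * (y - x) :=
    (hB'.comp (f := fun θ : ℝ => (t, x + θ * (y - x))) (by fun_prop)).mul_const _
  have := intervalIntegral.integral_eq_sub_of_hasDerivAt (a := (0 : ℝ)) (b := 1)
    (f := fun θ => B t (x + θ * (y - x))) (f' := fun θ => B' t (x + θ * (y - x)) * (y - x))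
    (fun θ _ => by
      refine (hd t (x + θ * (y - x))).comp θ ?_
      simpa using ((hasDerivAt_id θ).mul_const (y - x)).const_add x)
    (hc.intervalIntegrable _ _)
  rw [intervalIntegral.integral_mul_const] at this
  simp at this
  rw [segmentMean, mul_comm, this]

/-- Existence is Picard–Lindelöf on the whole interval, as `B` is bounded and Lipschitz in space.
For the derivative in the label, the difference of two trajectories solves a linear scalar equation
whose rate is the mean of `B'` over the segment between them. It is therefore an explicit
exponential, in which the two labels can be merged. -/
theorem exists_flow {T K M : ℝ} (hT : 0 < T) {B B' : ℝ → ℝ → ℝ}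
    (hB : Continuous (fun p : ℝ × ℝ => B p.1 p.2))
    (hB' : Continuous (fun p : ℝ × ℝ => B' p.1 p.2))
    (hd : ∀ t x, HasDerivAt (B t) (B' t x) x)
    (hM : ∀ t x, |B t x| ≤ M) (hK : ∀ t x, |B' t x| ≤ K) :
    ∃ X : ℝ → ℝ → ℝ, Continuous (fun p : ℝ × ℝ => X p.1 p.2) ∧ (∀ z, X 0 z = z) ∧
      (∀ t ∈ Ioo 0 T, ∀ z, HasDerivAt (fun t => X t z) (B t (X t z)) t) ∧
      (∀ t ∈ Icc 0 T, ∀ z, |X t z - z| ≤ M * T) ∧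
      ∀ t ∈ Icc 0 T, ∀ z, HasDerivAt (X t) (Real.exp (∫ s in (0 : ℝ)..t, B' s (X s z))) z := by
  have hM0 : 0 ≤ M := (abs_nonneg _).trans (hM 0 0)
  have hK0 : 0 ≤ K := (abs_nonneg _).trans (hK 0 0)
  have hLip : ∀ t, LipschitzWith K.toNNReal (B t) := fun t =>
    lipschitzWith_of_nnnorm_deriv_le (fun x => (hd t x).differentiableAt) (fun x => by
      rw [(hd t x).deriv, ← NNReal.coe_le_coe]
      simpa [hK0] using hK t x)
  have hT0 : (0 : ℝ) ∈ Icc 0 T := ⟨le_rfl, hT.le⟩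
  have hex : ∀ z : ℝ, ∃ α : ℝ → ℝ, α 0 = z ∧
      ∀ t ∈ Icc 0 T, HasDerivWithinAt α (B t (α t)) (Icc 0 T) t := by
    intro z
    have : IsPicardLindelof B (⟨0, hT0⟩ : Icc (0 : ℝ) T) z (M * T).toNNReal 0 M.toNNReal
        K.toNNReal :=
      { lipschitzOnWith := fun t _ => (hLip t).lipschitzOnWith
        continuousOn := fun x _ => (hB.comp (f := fun t : ℝ => (t, x)) (by fun_prop)).continuousOn
        norm_le := fun t _ x _ => by simpa [hM0] using hM t x
        mul_max_le := by simp [hM0, hT.le, mul_nonneg hM0 hT.le] }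
    exact this.exists_eq_forall_mem_Icc_hasDerivWithinAt₀
  choose α hα0 hα using hex
  have hcont : ∀ z, ContinuousOn (α z) (Icc 0 T) := fun z t ht => (hα z t ht).continuousWithinAt
  have hright : ∀ z, ∀ t ∈ Ico 0 T, HasDerivWithinAt (α z) (B t (α z t)) (Ici t) t :=
    fun z t ht => (hα z t ⟨ht.1, ht.2.le⟩).mono_of_mem_nhdsWithin
      (mem_of_superset (Icc_mem_nhdsGE ht.2) (Icc_subset_Icc_left ht.1))
  have hXlip : ∀ t ∈ Icc 0 T, LipschitzOnWith (Real.exp (K * T)).toNNReal (fun z => α z t) univ := by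
    intro t ht
    rw [lipschitzOnWith_univ]
    refine LipschitzWith.of_dist_le_mul fun z z' => ?_
    have := dist_le_of_trajectories_ODE (δ := dist z z') hLip (hcont z) (hright z) (hcont z')
      (hright z') (by rw [hα0, hα0]) t ht
    rw [mul_comm] at this
    refine this.trans (mul_le_mul_of_nonneg_right ?_ dist_nonneg)
    rw [Real.coe_toNNReal _ (Real.exp_pos _).le, Real.coe_toNNReal _ hK0]
    exact Real.exp_le_exp.2 (mul_le_mul_of_nonneg_left (by linarith [ht.2]) hK0)
  have hjoint : ContinuousOn (fun p : ℝ × ℝ => α p.1 p.2) (univ ×ˢ Icc 0 T) :=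
    continuousOn_prod_of_continuousOn_lipschitzOnWith _ _ (fun z _ => hcont z) hXlip
  have hXc : Continuous (fun p : ℝ × ℝ => α p.2 (clampTime T p.1)) := by
    refine hjoint.comp_continuous (f := fun p : ℝ × ℝ => (p.2, clampTime T p.1)) ?_ ?_
    · exact continuous_snd.prodMk ((continuous_clampTime T).comp continuous_fst)
    · exact fun p => ⟨mem_univ _, clampTime_mem hT.le _⟩
  have hXd : ∀ t ∈ Ioo 0 T, ∀ z, HasDerivAt (fun t => α z (clampTime T t))
      (B t (α z (clampTime T t))) t := by
    intro t ht z
    have h1 : Icc 0 T ∈ 𝓝 t := Icc_mem_nhds ht.1 ht.2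
    rw [clampTime_of_mem ⟨ht.1.le, ht.2.le⟩]
    refine ((hα z t ⟨ht.1.le, ht.2.le⟩).hasDerivAt h1).congr_of_eventuallyEq ?_
    filter_upwards [h1] with s hs
    rw [clampTime_of_mem hs]
  refine ⟨fun t z => α z (clampTime T t), hXc, fun z => ?_, hXd, ?_, ?_⟩
  · simp only [clampTime_of_mem hT0, hα0]
  · intro t ht z
    have := (convex_Icc 0 T).norm_image_sub_le_of_norm_hasDerivWithin_le
      (f := α z) (hα z) (C := M) (fun s _ => hM _ _) hT0 ht
    rw [hα0, Real.norm_eq_abs, Real.norm_eq_abs, sub_zero, abs_of_nonneg ht.1] at this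
    simp only [clampTime_of_mem ht]
    exact this.trans (mul_le_mul_of_nonneg_left ht.2 hM0)
  · intro t ht z
    have hq : Continuous (fun p : ℝ × ℝ => segmentMean B' p.2 (α z (clampTime T p.2))
        (α p.1 (clampTime T p.2))) := by
      refine (continuous_segmentMean hB').comp (f := fun p : ℝ × ℝ => (p.2,
        α z (clampTime T p.2), α p.1 (clampTime T p.2))) ?_
      exact continuous_snd.prodMk ((hXc.comp (f := fun p : ℝ × ℝ => (p.2, z)) (by fun_prop)).prodMk
        (hXc.comp (f := fun p : ℝ × ℝ => (p.2, p.1)) (by fun_prop)))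
    have hqs : ∀ z', Continuous (fun s => segmentMean B' s (α z (clampTime T s))
        (α z' (clampTime T s))) := fun z' =>
      hq.comp (f := fun s : ℝ => (z', s)) (by fun_prop)
    -- The integrating factor `exp (-∫ segmentMean)` makes the difference of the trajectories
    -- constant in time.
    have hdiff : ∀ z', α z' (clampTime T t) - α z (clampTime T t) = (z' - z) *
        Real.exp (∫ s in (0 : ℝ)..t, segmentMean B' s (α z (clampTime T s))
          (α z' (clampTime T s))) := by
      intro z'
      have hI : ∀ s, HasDerivAt (fun s => ∫ r in (0 : ℝ)..s, segmentMean B' r (α z (clampTime T r))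
          (α z' (clampTime T r))) (segmentMean B' s (α z (clampTime T s))
          (α z' (clampTime T s))) s := fun s =>
        intervalIntegral.integral_hasDerivAt_right ((hqs z').intervalIntegrable _ _)
          ((hqs z').stronglyMeasurableAtFilter _ _) (hqs z').continuousAt
      have hc : ∀ w, Continuous fun s => α w (clampTime T s) := fun w =>
        hXc.comp (f := fun s : ℝ => (s, w)) (by fun_prop)
      have := eq_of_hasDerivAt_zero (T := T) (f := fun s =>
        (α z' (clampTime T s) - α z (clampTime T s)) *
          Real.exp (-∫ r in (0 : ℝ)..s, segmentMean B' r (α z (clampTime T r))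
          (α z' (clampTime T r)))) ?_ ?_ ht
      · simp only [clampTime_of_mem hT0, hα0, intervalIntegral.integral_same, neg_zero,
          Real.exp_zero, mul_one] at this
        rw [← this, mul_assoc, ← Real.exp_add]
        simp
      · refine Continuous.continuousOn (((hc z').sub (hc z)).mul (Real.continuous_exp.comp
          (Continuous.neg ?_)))
        exact continuous_iff_continuousAt.2 fun s => (hI s).continuousAt
      · intro s hs
        refine (((hXd s hs z').sub (hXd s hs z)).mul (hI s).neg.exp).congr_deriv ?_
        rw [sub_eq_mul_segmentMean hB' hd]
        simp only [Pi.sub_apply]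
        ring
    rw [hasDerivAt_iff_tendsto_slope]
    have hlim : Tendsto (fun z' => Real.exp (∫ s in (0 : ℝ)..t,
        segmentMean B' s (α z (clampTime T s)) (α z' (clampTime T s)))) (𝓝[≠] z)
        (𝓝 (Real.exp (∫ s in (0 : ℝ)..t, B' s (α z (clampTime T s))))) := by
      have h1 : Continuous fun z' => Real.exp (∫ s in (0 : ℝ)..t,
          segmentMean B' s (α z (clampTime T s)) (α z' (clampTime T s))) :=
        Real.continuous_exp.comp
          (intervalIntegral.continuous_parametric_intervalIntegral_of_continuous' hq 0 t)
      have h2 := h1.tendsto z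
      simp only [segmentMean_self] at h2
      exact h2.mono_left nhdsWithin_le_nhds
    refine hlim.congr' ?_
    filter_upwards [self_mem_nhdsWithin] with z' hz'
    rw [slope_def_field, hdiff z', mul_div_cancel_left₀]
    exact sub_ne_zero.2 hz'
-- Calculus of orders with respect to a length scale
/-- `f = O(m^k)` uniformly on `D`. -/
def IsOrder {α : Type*} (D : Set α) (m : α → ℝ) (k : ℤ) (f : α → ℝ) : Prop :=
  ∃ C : ℝ, ∀ p ∈ D, |f p| ≤ C * m p ^ k

namespace IsOrder

variable {α β : Type*} {D : Set α} {m m' : α → ℝ} {k l : ℤ} {f g : α → ℝ}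

theorem congr_order (hf : IsOrder D m k f) (h : k = l) : IsOrder D m l f := h ▸ hf

theorem congr (hf : IsOrder D m k f) (h : ∀ p ∈ D, g p = f p) : IsOrder D m k g := by
  obtain ⟨C, hC⟩ := hf
  exact ⟨C, fun p hp => by rw [h p hp]; exact hC p hp⟩

theorem add (hf : IsOrder D m k f) (hg : IsOrder D m k g) :
    IsOrder D m k (fun p => f p + g p) := by
  obtain ⟨C, hC⟩ := hf
  obtain ⟨C', hC'⟩ := hg
  refine ⟨C + C', fun p hp => (abs_add_le _ _).trans ?_⟩
  rw [add_mul]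
  exact add_le_add (hC p hp) (hC' p hp)

theorem const_mul (c : ℝ) (hf : IsOrder D m k f) : IsOrder D m k (fun p => c * f p) := by
  obtain ⟨C, hC⟩ := hf
  refine ⟨|c| * C, fun p hp => ?_⟩
  rw [abs_mul, mul_assoc]
  exact mul_le_mul_of_nonneg_left (hC p hp) (abs_nonneg c)

theorem sub (hf : IsOrder D m k f) (hg : IsOrder D m k g) :
    IsOrder D m k (fun p => f p - g p) :=
  (hf.add (hg.const_mul (-1))).congr fun p _ => by ring

theorem mul (hm : ∀ p ∈ D, 0 < m p) (hf : IsOrder D m k f) (hg : IsOrder D m l g) :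
    IsOrder D m (k + l) (fun p => f p * g p) := by
  obtain ⟨C, hC⟩ := hf
  obtain ⟨C', hC'⟩ := hg
  refine ⟨C * C', fun p hp => ?_⟩
  rw [abs_mul, zpow_add₀ (hm p hp).ne']
  calc |f p| * |g p| ≤ (C * m p ^ k) * (C' * m p ^ l) :=
        mul_le_mul (hC p hp) (hC' p hp) (abs_nonneg _) ((abs_nonneg _).trans (hC p hp))
    _ = _ := by ring

theorem pow (hm : ∀ p ∈ D, 0 < m p) (hf : IsOrder D m k f) (n : ℕ) :
    IsOrder D m (n * k) (fun p => f p ^ n) := by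
  induction n with
  | zero => exact ⟨1, fun p _ => by simp⟩
  | succ n ih =>
    refine ((ih.mul hm hf).congr_order (by push_cast; ring)).congr fun p _ => pow_succ _ _

theorem scale_zpow (hm : ∀ p ∈ D, 0 < m p) (k : ℤ) : IsOrder D m k (fun p => m p ^ k) :=
  ⟨1, fun p hp => by rw [abs_of_pos (zpow_pos (hm p hp) k), one_mul]⟩

theorem scale (hm : ∀ p ∈ D, 0 < m p) : IsOrder D m 1 m :=
  (scale_zpow hm 1).congr fun p _ => by simp

theorem div_scale_pow (hm : ∀ p ∈ D, 0 < m p) (hf : IsOrder D m k f) (n : ℕ) :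
    IsOrder D m (k - n) (fun p => f p / m p ^ n) := by
  refine (hf.mul hm (scale_zpow hm (-(n : ℤ)))).congr fun p _ => ?_
  rw [zpow_neg, zpow_natCast, div_eq_mul_inv]

theorem mono_order (hm : ∀ p ∈ D, 0 < m p) {M : ℝ} (hM : ∀ p ∈ D, m p ≤ M)
    (hf : IsOrder D m k f) (hl : l ≤ k) : IsOrder D m l f := by
  obtain ⟨C, hC⟩ := hf
  obtain ⟨n, hn⟩ := Int.le.dest hl
  refine ⟨|C| * |M| ^ n, fun p hp => (hC p hp).trans ?_⟩
  have hmp := hm p hp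
  rw [← hn, zpow_add₀ hmp.ne', zpow_natCast]
  have h1 : m p ^ n ≤ |M| ^ n := pow_le_pow_left₀ hmp.le ((hM p hp).trans (le_abs_self M)) n
  have h2 : 0 < m p ^ l := zpow_pos hmp l
  calc C * (m p ^ l * m p ^ n) ≤ |C| * (m p ^ l * |M| ^ n) := by
        refine mul_le_mul (le_abs_self C) ?_ (by positivity) (abs_nonneg C)
        exact mul_le_mul_of_nonneg_left h1 h2.le
    _ = _ := by ring

theorem comp {E : Set β} (hf : IsOrder D m k f) (φ : β → α) (h : ∀ q ∈ E, φ q ∈ D) :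
    IsOrder E (m ∘ φ) k (f ∘ φ) := by
  obtain ⟨C, hC⟩ := hf
  exact ⟨C, fun q hq => hC _ (h q hq)⟩

/-- Both comparisons are needed because exponents may be negative: `h1` serves `k ≥ 0` and `h2`
serves `k ≤ 0`. It moves bounds from the current solution to the initial data. -/
theorem change_scale (hm : ∀ p ∈ D, 0 < m p) (hm' : ∀ p ∈ D, 0 < m' p) {κ : ℝ}
    (h1 : ∀ p ∈ D, m p ≤ κ * m' p) (h2 : ∀ p ∈ D, m' p ≤ κ * m p)
    (hf : IsOrder D m k f) : IsOrder D m' k f := by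
  obtain ⟨C, hC⟩ := hf
  obtain ⟨n, rfl | rfl⟩ := Int.eq_nat_or_neg k
  · refine ⟨|C| * κ ^ n, fun p hp => (hC p hp).trans ?_⟩
    have := pow_le_pow_left₀ (hm p hp).le (h1 p hp) n
    rw [mul_pow] at this
    have h3 := pow_pos (hm p hp) n
    rw [zpow_natCast, zpow_natCast, mul_assoc]
    exact mul_le_mul (le_abs_self C) this h3.le (abs_nonneg C)
  · refine ⟨|C| * κ ^ n, fun p hp => (hC p hp).trans ?_⟩
    have := pow_le_pow_left₀ (hm' p hp).le (h2 p hp) n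
    rw [mul_pow] at this
    have h3 := pow_pos (hm p hp) n
    have h4 := pow_pos (hm' p hp) n
    rw [zpow_neg, zpow_natCast, zpow_neg, zpow_natCast, mul_assoc]
    refine mul_le_mul (le_abs_self C) ?_ (by positivity) (abs_nonneg C)
    rw [inv_le_iff_one_le_mul₀ h3]
    calc 1 = m' p ^ n * (m' p ^ n)⁻¹ := by field_simp
      _ ≤ κ ^ n * m p ^ n * (m' p ^ n)⁻¹ := by gcongr
      _ = _ := by ring

theorem of_abs_mul_pow_le (hm : ∀ p ∈ D, 0 < m p) {C : ℝ} (n : ℕ)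
    (h : ∀ p ∈ D, |f p| * m p ^ n ≤ C) : IsOrder D m (-n) f :=
  ⟨C, fun p hp => by
    rw [zpow_neg, zpow_natCast, ← div_eq_mul_inv, le_div_iff₀ (pow_pos (hm p hp) n)]
    exact h p hp⟩

end IsOrder

/-- A nonnegative function cannot descend steeply from a small value when its second derivative is
bounded: the Taylor bound would become negative. The remainder is estimated by `M (y - x)²` without
the factor 1/2, whence 4 instead of the sharp 2. -/
theorem sq_deriv_le_of_nonneg {f f' f'' : ℝ → ℝ} {M : ℝ} (hf : ∀ x, 0 ≤ f x)
    (h1 : ∀ x, HasDerivAt f (f' x) x) (h2 : ∀ x, HasDerivAt f' (f'' x) x)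
    (hM : ∀ x, |f'' x| ≤ M) (x : ℝ) : f' x ^ 2 ≤ 4 * M * f x := by
  -- A positive `M'` allows division even when `M = 0`.
  have key : ∀ M' > 0, M ≤ M' → f' x ^ 2 ≤ 4 * M' * f x := by
    intro M' hM' hle
    have hL : ∀ y, |f' y - f' x| ≤ M' * |y - x| := fun y => by
      simpa using convex_univ.norm_image_sub_le_of_norm_hasDerivWithin_le (f := f') (f' := f'')
        (fun z _ => (h2 z).hasDerivWithinAt) (fun z _ => (hM z).trans hle) (mem_univ x)
        (mem_univ y)
    have hT : ∀ y, |f y - f x - f' x * (y - x)| ≤ M' * |y - x| * |y - x| := by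
      intro y
      have := (convex_uIcc x y).norm_image_sub_le_of_norm_hasDerivWithin_le
        (f := fun z => f z - f' x * z) (f' := fun z => f' z - f' x) (C := M' * |y - x|)
        (fun z _ => ((h1 z).sub (by simpa using (hasDerivAt_id z).const_mul (f' x))
          ).hasDerivWithinAt)
        (fun z hz => (hL z).trans (mul_le_mul_of_nonneg_left
          (abs_sub_left_of_mem_uIcc hz) hM'.le)) left_mem_uIcc right_mem_uIcc
      rw [Real.norm_eq_abs, Real.norm_eq_abs] at this
      convert this using 2
      ring
    -- The step minimizing the Taylor upper bound `f x - f' x τ + M' τ²`.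
    set τ := f' x / (2 * M') with hτ
    have h3 := (abs_le.1 (hT (x - τ))).2
    have h4 : x - τ - x = -τ := by ring
    rw [h4, mul_assoc, abs_mul_abs_self] at h3
    have h5 : f' x = 2 * M' * τ := by rw [hτ]; field_simp
    have h6 := hf (x - τ)
    rw [h5] at h3 ⊢
    nlinarith
  refine le_of_forall_pos_le_add fun ε hε => ?_
  have hM0 : 0 ≤ M := (abs_nonneg _).trans (hM 0)
  have hd : 0 < 4 * f x + 1 := by linarith [hf x]
  have := key (M + ε / (4 * f x + 1)) (by positivity) (by linarith [div_pos hε hd])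
  have h7 : ε / (4 * f x + 1) * (4 * f x) ≤ ε := by
    rw [div_mul_eq_mul_div, div_le_iff₀ hd]
    nlinarith [hf x]
  nlinarith
-- The sixth root of a profile and the mass derivatives of its fifth power
/-- The sixth root of a profile; the length scale near a zero of the profile is its fourth power. -/
noncomputable def root (v : ℝ → ℝ) (x : ℝ) : ℝ := v x ^ (1 / 6 : ℝ)

/-- The derivative of `root v` where `v` is positive. -/
noncomputable def rootD1 (v : ℝ → ℝ) (x : ℝ) : ℝ :=
  iteratedDeriv 1 (fun y => v y ^ 2) x / (12 * root v x ^ 11)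

/-- The second derivative of `root v` where `v` is positive. -/
noncomputable def rootD2 (v : ℝ → ℝ) (x : ℝ) : ℝ :=
  (iteratedDeriv 2 (fun y => v y ^ 2) x - 132 * root v x ^ 10 * rootD1 v x ^ 2) /
    (12 * root v x ^ 11)

/-- The third derivative of `root v` where `v` is positive. -/
noncomputable def rootD3 (v : ℝ → ℝ) (x : ℝ) : ℝ :=
  (iteratedDeriv 3 (fun y => v y ^ 2) x - 396 * root v x ^ 10 * rootD1 v x * rootD2 v x
    - 1320 * root v x ^ 9 * rootD1 v x ^ 3) / (12 * root v x ^ 11)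

/-- `(v⁻¹ ∂ₓ) v^(5/6)` where `v` is positive. -/
noncomputable def massD1 (v : ℝ → ℝ) (x : ℝ) : ℝ := 5 * rootD1 v x / root v x ^ 2

/-- `(v⁻¹ ∂ₓ)² v^(5/6)` where `v` is positive. -/
noncomputable def massD2 (v : ℝ → ℝ) (x : ℝ) : ℝ :=
  5 * rootD2 v x / root v x ^ 8 - 10 * rootD1 v x ^ 2 / root v x ^ 9

/-- `(v⁻¹ ∂ₓ)³ v^(5/6)` where `v` is positive. -/
noncomputable def massD3 (v : ℝ → ℝ) (x : ℝ) : ℝ :=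
  5 * rootD3 v x / root v x ^ 14 - 60 * (rootD1 v x * rootD2 v x) / root v x ^ 15
    + 90 * rootD1 v x ^ 3 / root v x ^ 16

section Root

variable {v : ℝ → ℝ}

theorem root_pos {x : ℝ} (hx : 0 < v x) : 0 < root v x := Real.rpow_pos_of_pos hx _

theorem root_nonneg {x : ℝ} (hx : 0 ≤ v x) : 0 ≤ root v x := Real.rpow_nonneg hx _

theorem root_pow_six {x : ℝ} (hx : 0 ≤ v x) : root v x ^ 6 = v x := by
  rw [root, ← Real.rpow_natCast, ← Real.rpow_mul hx]
  norm_num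

theorem root_pow_eight {x : ℝ} (hx : 0 ≤ v x) : root v x ^ 8 = v x ^ ((4 : ℝ) / 3) := by
  rw [root, ← Real.rpow_natCast, ← Real.rpow_mul hx]
  norm_num

theorem continuous_of_sq (hv : ∀ x, 0 ≤ v x) (h : Continuous fun x => v x ^ 2) :
    Continuous v :=
  h.sqrt.congr fun x => Real.sqrt_sq (hv x)

theorem hasDerivAt_root (hv : ∀ x, 0 ≤ v x) (h : ContDiff ℝ 3 fun x => v x ^ 2) {x : ℝ}
    (hx : 0 < v x) : HasDerivAt (root v) (rootD1 v x) x := by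
  have h1 : HasDerivAt (fun y => v y ^ 2) (iteratedDeriv 1 (fun y => v y ^ 2) x) x := by
    rw [iteratedDeriv_one]
    exact (h.differentiable (by norm_num) x).hasDerivAt
  have hs := root_pos hx
  have heq : ∀ y, (v y ^ 2) ^ (1 / 12 : ℝ) = root v y := fun y => by
    rw [root, ← Real.rpow_natCast, ← Real.rpow_mul (hv y)]
    norm_num
  have h2 := h1.rpow_const (p := 1 / 12) (Or.inl (by positivity))
  rw [Real.rpow_sub_one (by positivity), heq, ← root_pow_six hx.le] at h2
  simp_rw [heq] at h2
  refine h2.congr_deriv ?_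
  rw [rootD1]
  field_simp

theorem hasDerivAt_iteratedDeriv {f : ℝ → ℝ} {k j : ℕ} (h : ContDiff ℝ k f) (hj : j < k) (x : ℝ) :
    HasDerivAt (iteratedDeriv j f) (iteratedDeriv (j + 1) f x) x := by
  rw [iteratedDeriv_succ]
  exact ((h.differentiable_iteratedDeriv j (by exact_mod_cast hj)) x).hasDerivAt

theorem hasDerivAt_rootD1 (hv : ∀ x, 0 ≤ v x) (h : ContDiff ℝ 3 fun x => v x ^ 2) {x : ℝ}
    (hx : 0 < v x) : HasDerivAt (rootD1 v) (rootD2 v x) x := by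
  have hs := root_pos hx
  have h0 := hasDerivAt_root hv h hx
  have := (hasDerivAt_iteratedDeriv (k := 3) h (j := 1) (by norm_num) x).div
    ((h0.pow 11).const_mul 12) (by simp only [Pi.pow_apply]; positivity)
  refine this.congr_deriv ?_
  have h1 : iteratedDeriv 1 (fun y => v y ^ 2) x = 12 * root v x ^ 11 * rootD1 v x := by
    rw [rootD1]; field_simp
  simp only [Pi.pow_apply]
  rw [rootD2, h1]
  field_simp
  ring

theorem hasDerivAt_rootD2 (hv : ∀ x, 0 ≤ v x) (h : ContDiff ℝ 3 fun x => v x ^ 2) {x : ℝ}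
    (hx : 0 < v x) : HasDerivAt (rootD2 v) (rootD3 v x) x := by
  have hs := root_pos hx
  have h0 := hasDerivAt_root hv h hx
  have h1 := hasDerivAt_rootD1 hv h hx
  have := ((hasDerivAt_iteratedDeriv (k := 3) h (j := 2) (by norm_num) x).sub
    (((h0.pow 10).const_mul 132).mul (h1.pow 2))).div
    ((h0.pow 11).const_mul 12) (by simp only [Pi.pow_apply]; positivity)
  refine this.congr_deriv ?_
  have h2 : iteratedDeriv 2 (fun y => v y ^ 2) x =
      12 * root v x ^ 11 * rootD2 v x + 132 * root v x ^ 10 * rootD1 v x ^ 2 := by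
    rw [rootD2]; field_simp; ring
  simp only [Pi.pow_apply, Pi.mul_apply, Pi.sub_apply]
  rw [rootD3, h2]
  field_simp
  ring

/-- The factor `root v x ^ 6` is `v x`: it converts a mass derivative into a space derivative. -/
theorem hasDerivAt_massD1 (hv : ∀ x, 0 ≤ v x) (h : ContDiff ℝ 3 fun x => v x ^ 2) {x : ℝ}
    (hx : 0 < v x) : HasDerivAt (massD1 v) (root v x ^ 6 * massD2 v x) x := by
  have hs := root_pos hx
  refine (((hasDerivAt_rootD1 hv h hx).const_mul 5).div ((hasDerivAt_root hv h hx).pow 2)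
    (by simp only [Pi.pow_apply]; positivity)).congr_deriv ?_
  simp only [Pi.pow_apply, massD2]
  field_simp
  ring

theorem hasDerivAt_massD2 (hv : ∀ x, 0 ≤ v x) (h : ContDiff ℝ 3 fun x => v x ^ 2) {x : ℝ}
    (hx : 0 < v x) : HasDerivAt (massD2 v) (root v x ^ 6 * massD3 v x) x := by
  have hs := root_pos hx
  have h0 := hasDerivAt_root hv h hx
  have h1 := hasDerivAt_rootD1 hv h hx
  have h2 := hasDerivAt_rootD2 hv h hx
  refine (((h2.const_mul 5).div (h0.pow 8) (by simp only [Pi.pow_apply]; positivity)).sub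
    (((h1.pow 2).const_mul 10).div (h0.pow 9) (by simp only [Pi.pow_apply]; positivity))).congr_deriv ?_
  simp only [Pi.pow_apply, massD3]
  field_simp
  ring

theorem velocity_eq_massD {x : ℝ} (hx : 0 < v x) (μ : ℝ) :
    1 / 2 * iteratedDeriv 2 (fun y => v y ^ 2) x + μ * v x ^ 2 =
      6 / 5 * root v x ^ 19 * massD2 v x + 78 / 25 * root v x ^ 14 * massD1 v x ^ 2 +
        μ * root v x ^ 12 := by
  have hs := root_pos hx
  have h2 : iteratedDeriv 2 (fun y => v y ^ 2) x =
      12 * root v x ^ 11 * rootD2 v x + 132 * root v x ^ 10 * rootD1 v x ^ 2 := by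
    rw [rootD2]; field_simp; ring
  rw [h2, ← root_pow_six hx.le, massD1, massD2]
  field_simp
  ring

/-- The dispersive operator acting on `v^(5/6)` in the mass coordinate, in terms of `s = v^(1/6)` and
of the mass derivatives `g₁, g₂, g₃` of `s⁵`. -/
noncomputable def dispersion (μ s g₁ g₂ g₃ : ℝ) : ℝ :=
  (s ^ 5) ^ 6 * g₃ + 9 * (s ^ 5) ^ 5 * g₁ * g₂ + 182 / 25 * (s ^ 5) ^ 4 * g₁ ^ 3 +
    2 * μ * s ^ 18 * g₁

/-- The left side is the decay rate of `u^(5/6)` along the flow. For this power the coefficient of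
`g₁ g₂` is 9 = (3/2) · 6, which is what the cancellation in the energy identity requires. -/
theorem dispersion_eq_velocity_deriv {x : ℝ} (hx : 0 < v x) (μ : ℝ) :
    5 / 6 * root v x ^ 5 * (1 / 2 * iteratedDeriv 3 (fun y => v y ^ 2) x +
      μ * iteratedDeriv 1 (fun y => v y ^ 2) x) =
      dispersion μ (root v x) (massD1 v x) (massD2 v x) (massD3 v x) := by
  have hs := root_pos hx
  have h1 : iteratedDeriv 1 (fun y => v y ^ 2) x = 12 * root v x ^ 11 * rootD1 v x := by
    rw [rootD1]; field_simp
  have h3 : iteratedDeriv 3 (fun y => v y ^ 2) x =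
      12 * root v x ^ 11 * rootD3 v x + 396 * root v x ^ 10 * rootD1 v x * rootD2 v x
        + 1320 * root v x ^ 9 * rootD1 v x ^ 3 := by
    rw [rootD3]; field_simp; ring
  rw [h1, h3, dispersion, massD1, massD2, massD3]
  field_simp
  ring

end Root

/-! ### Size of the derivatives near the zeros of the solution -/

section Order

variable {T : ℝ} {u : ℝ → ℝ → ℝ}

/-- The space-time positivity set of `u`. -/
def positivitySet (T : ℝ) (u : ℝ → ℝ → ℝ) : Set (ℝ × ℝ) := {p | p.1 ∈ Icc 0 T ∧ 0 < u p.1 p.2}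

theorem root_pos_of_mem : ∀ p ∈ positivitySet T u, 0 < root (u p.1) p.2 :=
  fun _ hp => root_pos hp.2

theorem iteratedDeriv_pow_eq {v : ℝ → ℝ} (hv : ∀ x, 0 ≤ v x) (h : ContDiff ℝ 3 fun x => v x ^ 2)
    (hp : ContDiff ℝ 2 fun x => v x ^ ((4 : ℝ) / 3)) {x : ℝ} (hx : 0 < v x) :
    iteratedDeriv 1 (fun x => v x ^ ((4 : ℝ) / 3)) x = 8 * root v x ^ 7 * rootD1 v x ∧
    iteratedDeriv 2 (fun x => v x ^ ((4 : ℝ) / 3)) x =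
      8 * root v x ^ 7 * rootD2 v x + 56 * root v x ^ 6 * rootD1 v x ^ 2 := by
  have hd : ∀ y, 0 < v y →
      iteratedDeriv 1 (fun x => v x ^ ((4 : ℝ) / 3)) y = 8 * root v y ^ 7 * rootD1 v y := by
    intro y hy
    have h1 := (hasDerivAt_root hv h hy).pow 8
    have h2 := hasDerivAt_iteratedDeriv (k := 2) hp (j := 0) (by norm_num) y
    rw [iteratedDeriv_zero] at h2
    have h3 : root v ^ 8 = fun x => v x ^ ((4 : ℝ) / 3) :=
      funext fun x => root_pow_eight (hv x)
    rw [h3] at h1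
    rw [h2.unique h1]
    norm_num
  refine ⟨hd x hx, ?_⟩
  have h2 := hasDerivAt_iteratedDeriv (k := 2) hp (j := 1) (by norm_num) x
  have h1 := (((hasDerivAt_root hv h hx).pow 7).const_mul 8).mul (hasDerivAt_rootD1 hv h hx)
  have hev : ∀ᶠ y in 𝓝 x, 0 < v y :=
    (continuous_of_sq hv h.continuous).continuousAt.eventually_const_lt hx
  have h3 := h1.congr_of_eventuallyEq (f₁ := iteratedDeriv 1 fun x => v x ^ ((4 : ℝ) / 3))
    (hev.mono fun y hy => hd y hy)
  rw [h2.unique h3]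
  simp only [Pi.pow_apply]
  ring

variable (hu : ∀ t ∈ Icc 0 T, ∀ x, 0 ≤ u t x) (hsq : ContInTimeCb T 3 fun t x => u t x ^ 2)
  (hpow : ContInTimeCb T 2 fun t x => u t x ^ ((4 : ℝ) / 3))
include hu hsq hpow

/-- With `s = root u`, applying `sq_deriv_le_of_nonneg` to `s⁸ = u^(4/3)` gives 64 s¹⁴ s'² ≤ 4 M s⁸,
so that s³ s' is bounded. -/
theorem isOrder_rootD1 : IsOrder (positivitySet T u) (fun p => root (u p.1) p.2) (-3)
    (fun p => rootD1 (u p.1) p.2) := by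
  obtain ⟨M, hM⟩ := hpow.exists_bound (j := 2) le_rfl
  refine IsOrder.of_abs_mul_pow_le root_pos_of_mem (C := M + 1) 3 ?_
  rintro ⟨t, x⟩ ⟨ht, hx⟩
  have hp := (hpow.1 t ht).1
  have h1 := sq_deriv_le_of_nonneg (f := fun y => u t y ^ ((4 : ℝ) / 3))
    (fun y => Real.rpow_nonneg (hu t ht y) _)
    (fun y => by simpa using hasDerivAt_iteratedDeriv (k := 2) hp (j := 0) (by norm_num) y)
    (fun y => hasDerivAt_iteratedDeriv (k := 2) hp (j := 1) (by norm_num) y) (hM t ht) x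
  simp only at h1
  have hM0 : 0 ≤ M := (abs_nonneg _).trans (hM t ht x)
  have hs := root_pos hx
  simp only at hx hs ⊢
  rw [(iteratedDeriv_pow_eq (hu t ht) (hsq.1 t ht).1 hp hx).1, ← root_pow_eight hx.le] at h1
  have h2 : (rootD1 (u t) x * root (u t) x ^ 3) ^ 2 ≤ M := by
    have h8 : 0 < root (u t) x ^ 8 := by positivity
    have : 64 * (rootD1 (u t) x * root (u t) x ^ 3) ^ 2 * root (u t) x ^ 8 ≤
        4 * M * root (u t) x ^ 8 := by linarith
    have := le_of_mul_le_mul_right this h8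
    linarith
  rw [← abs_of_pos (pow_pos hs 3), ← abs_mul]
  exact abs_le_of_sq_le_sq (by nlinarith) (by linarith)

/-- Solve (s⁸)'' = 8 s⁷ s'' + 56 s⁶ s'² for s''; the left side and the last term are bounded. -/
theorem isOrder_rootD2 : IsOrder (positivitySet T u) (fun p => root (u p.1) p.2) (-7)
    (fun p => rootD2 (u p.1) p.2) := by
  obtain ⟨M, hM⟩ := hpow.exists_bound (j := 2) le_rfl
  have hm := root_pos_of_mem (T := T) (u := u)
  have h2 : IsOrder (positivitySet T u) (fun p => root (u p.1) p.2) 0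
      (fun p => iteratedDeriv 2 (fun y => u p.1 y ^ ((4 : ℝ) / 3)) p.2) :=
    ⟨M, fun p hp => by simpa using hM p.1 hp.1 p.2⟩
  have h1 := (((IsOrder.scale hm).pow hm 6).mul hm
    ((isOrder_rootD1 hu hsq hpow).pow hm 2)).const_mul 56
  refine (((h2.sub (h1.congr_order (by norm_num))).div_scale_pow hm 7).const_mul (1 / 8)).congr ?_
  rintro ⟨t, x⟩ ⟨ht, hx⟩
  have hs := root_pos hx
  simp only at hx hs ⊢
  rw [(iteratedDeriv_pow_eq (hu t ht) (hsq.1 t ht).1 (hpow.1 t ht).1 hx).2]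
  field_simp
  ring

/-- The third derivative comes from `u² = s¹²`, as `u^(4/3)` is only controlled to second order. The
lower terms of (s¹²)''' have orders 10 - 3 - 7 = 0 and 9 - 3·3 = 0. -/
theorem isOrder_rootD3 : IsOrder (positivitySet T u) (fun p => root (u p.1) p.2) (-11)
    (fun p => rootD3 (u p.1) p.2) := by
  obtain ⟨M, hM⟩ := hsq.exists_bound (j := 3) le_rfl
  have hm := root_pos_of_mem (T := T) (u := u)
  have h3 : IsOrder (positivitySet T u) (fun p => root (u p.1) p.2) 0
      (fun p => iteratedDeriv 3 (fun y => u p.1 y ^ 2) p.2) :=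
    ⟨M, fun p hp => by simpa using hM p.1 hp.1 p.2⟩
  have s := IsOrder.scale hm
  have d1 := isOrder_rootD1 hu hsq hpow
  have d2 := isOrder_rootD2 hu hsq hpow
  have a := (((s.pow hm 10).mul hm (d1.mul hm d2)).const_mul 396).congr_order (l := 0) (by norm_num)
  have b := (((s.pow hm 9).mul hm (d1.pow hm 3)).const_mul 1320).congr_order (l := 0) (by norm_num)
  refine ((((h3.sub a).sub b).div_scale_pow hm 11).const_mul (1 / 12)).congr ?_
  rintro ⟨t, x⟩ ⟨ht, hx⟩
  have hs := root_pos hx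
  simp only at hx hs ⊢
  rw [rootD3]
  field_simp

theorem isOrder_massD1 : IsOrder (positivitySet T u) (fun p => root (u p.1) p.2) (-5)
    (fun p => massD1 (u p.1) p.2) :=
  (((isOrder_rootD1 hu hsq hpow).const_mul 5).div_scale_pow root_pos_of_mem 2).congr_order
    (by norm_num)

theorem isOrder_massD2 : IsOrder (positivitySet T u) (fun p => root (u p.1) p.2) (-15)
    (fun p => massD2 (u p.1) p.2) := by
  have hm := root_pos_of_mem (T := T) (u := u)
  have d1 := isOrder_rootD1 hu hsq hpow
  have d2 := isOrder_rootD2 hu hsq hpow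
  exact (((d2.const_mul 5).div_scale_pow hm 8).congr_order (by norm_num)).sub
    ((((d1.pow hm 2).const_mul 10).div_scale_pow hm 9).congr_order (by norm_num))

theorem isOrder_massD3 : IsOrder (positivitySet T u) (fun p => root (u p.1) p.2) (-25)
    (fun p => massD3 (u p.1) p.2) := by
  have hm := root_pos_of_mem (T := T) (u := u)
  have d1 := isOrder_rootD1 hu hsq hpow
  have d2 := isOrder_rootD2 hu hsq hpow
  have d3 := isOrder_rootD3 hu hsq hpow
  exact ((((d3.const_mul 5).div_scale_pow hm 14).congr_order (by norm_num)).sub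
    ((((d1.mul hm d2).const_mul 60).div_scale_pow hm 15).congr_order (by norm_num))).add
    ((((d1.pow hm 3).const_mul 90).div_scale_pow hm 16).congr_order (by norm_num))

end Order
-- The equation in Lagrangian labels
/-- The labels in the positivity set of the initial data, at all times of `[0,T]`. -/
def labelSet (T : ℝ) (u₀ : ℝ → ℝ) : Set (ℝ × ℝ) := {p | p.1 ∈ Icc 0 T ∧ 0 < u₀ p.2}

/-- The equation in Lagrangian labels: `S = u^(1/6)` along the flow, `β` is the divergence of the
velocity along the flow, and `D₁, D₂, D₃` are the derivatives of `S⁵` with respect to the mass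
coordinate, that is, with respect to `u₀⁻¹ ∂_z`. -/
structure IsLagrangianSolution (μ T : ℝ) (u₀ : ℝ → ℝ) (S β D₁ D₂ D₃ : ℝ → ℝ → ℝ) : Prop where
  continuous_S : Continuous fun p : ℝ × ℝ => S p.1 p.2
  continuous_β : Continuous fun p : ℝ × ℝ => β p.1 p.2
  bounded_β : ∃ K, ∀ t z, |β t z| ≤ K
  initial : ∀ z, S 0 z = root u₀ z
  comparable : ∃ κ > 0, ∀ t ∈ Icc 0 T, ∀ z, S t z ≤ κ * root u₀ z ∧ root u₀ z ≤ κ * S t z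
  hasDerivAt_time : ∀ t ∈ Ioo 0 T, ∀ z,
    HasDerivAt (fun t => S t z ^ 5) (-(5 / 6 * S t z ^ 5 * β t z)) t
  evolution : ∀ t ∈ Icc 0 T, ∀ z, 0 < u₀ z →
    5 / 6 * S t z ^ 5 * β t z = dispersion μ (S t z) (D₁ t z) (D₂ t z) (D₃ t z)
  hasDerivAt_S : ∀ t ∈ Icc 0 T, ∀ z, 0 < u₀ z →
    HasDerivAt (S t) (u₀ z * (D₁ t z / (5 * S t z ^ 4))) z
  hasDerivAt_D₁ : ∀ t ∈ Icc 0 T, ∀ z, 0 < u₀ z → HasDerivAt (D₁ t) (u₀ z * D₂ t z) z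
  hasDerivAt_D₂ : ∀ t ∈ Icc 0 T, ∀ z, 0 < u₀ z → HasDerivAt (D₂ t) (u₀ z * D₃ t z) z
  order_D₁ : IsOrder (labelSet T u₀) (fun p => root u₀ p.2) (-5) fun p => D₁ p.1 p.2
  order_D₂ : IsOrder (labelSet T u₀) (fun p => root u₀ p.2) (-15) fun p => D₂ p.1 p.2
  order_D₃ : IsOrder (labelSet T u₀) (fun p => root u₀ p.2) (-25) fun p => D₃ p.1 p.2

theorem surjective_of_abs_sub_le {f : ℝ → ℝ} (hf : Continuous f) {C : ℝ}
    (h : ∀ z, |f z - z| ≤ C) : Function.Surjective f := by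
  refine hf.surjective ?_ ?_
  · refine tendsto_atTop_mono (f := fun z => z + -C) (g := f) (fun z => ?_)
      (tendsto_atTop_add_const_right _ _ tendsto_id)
    linarith [(abs_le.1 (h z)).1]
  · refine tendsto_atBot_mono (g := f) (f := fun z => z + C) (fun z => ?_)
      (tendsto_atBot_add_const_right _ _ tendsto_id)
    linarith [(abs_le.1 (h z)).2]

/-- Along a curve moving with the velocity, a hydrodynamic solution decays at the rate given by the
divergence of the velocity. -/
theorem IsHydrodynamicSolution.hasDerivAt_along {μ T : ℝ} {u₀ : ℝ → ℝ} {u : ℝ → ℝ → ℝ}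
    (hu : IsHydrodynamicSolution μ T u₀ u) {t : ℝ} (ht : t ∈ Ioo 0 T) {γ : ℝ → ℝ} {b' : ℝ}
    (hγ : HasDerivAt γ (velocity μ u t (γ t)) t)
    (hb : HasDerivAt (velocity μ u t) b' (γ t)) :
    HasDerivAt (fun s => u s (γ s)) (-(b' * u t (γ t))) t := by
  have hnhds : Icc 0 T ×ˢ (univ : Set ℝ) ∈ 𝓝 (t, γ t) :=
    prod_mem_nhds (Icc_mem_nhds ht.1 ht.2) univ_mem
  have hF := ((hu.contDiffOn.contDiffAt hnhds).differentiableAt (by norm_num)).hasFDerivAt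
  set L := fderiv ℝ (fun p : ℝ × ℝ => u p.1 p.2) (t, γ t)
  have ht' : HasDerivAt (fun s => u s (γ t)) (L (1, 0)) t :=
    hF.comp_hasDerivAt (f := fun s => (s, γ t)) t
      ((hasDerivAt_id t).prodMk (hasDerivAt_const t (γ t)))
  have hx' : HasDerivAt (u t) (L (0, 1)) (γ t) :=
    hF.comp_hasDerivAt (f := fun y => (t, y)) (γ t)
      ((hasDerivAt_const (γ t) t).prodMk (hasDerivAt_id (γ t)))
  have hc : HasDerivAt (fun s => u s (γ s)) (L (1, velocity μ u t (γ t))) t :=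
    hF.comp_hasDerivAt (f := fun s => (s, γ s)) t ((hasDerivAt_id t).prodMk hγ)
  have heq := hu.equation t ⟨ht.1.le, ht.2.le⟩ (γ t)
  rw [derivWithin_of_mem_nhds (Icc_mem_nhds ht.1 ht.2), ht'.deriv,
    (show HasDerivAt (fun y => velocity μ u t y * u t y) _ (γ t) from hb.mul hx').deriv] at heq
  refine hc.congr_deriv ?_
  have : ((1 : ℝ), velocity μ u t (γ t)) = (1, 0) + velocity μ u t (γ t) • ((0 : ℝ), (1 : ℝ)) := by
    simp
  rw [this, map_add, map_smul, smul_eq_mul]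
  linarith

/-- Both `u` along the flow and the Jacobian of the flow are exponentials of `∓∫ β`, so their
product is `u₀`. This conservation of mass turns `u⁻¹ ∂ₓ` into `u₀⁻¹ ∂_z`. The time derivative of
the flow is recorded in terms of `S`, `D₁`, `D₂` so that flows can be recovered once these are known
to agree. -/
theorem exists_lagrangianSolution {μ T : ℝ} (hT : 0 < T) {u₀ : ℝ → ℝ} {u : ℝ → ℝ → ℝ}
    (hu : IsHydrodynamicSolution μ T u₀ u) (hsq : ContInTimeCb T 3 fun t x => u t x ^ 2)
    (hpow : ContInTimeCb T 2 fun t x => u t x ^ ((4 : ℝ) / 3)) :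
    ∃ X S β D₁ D₂ D₃ : ℝ → ℝ → ℝ, IsLagrangianSolution μ T u₀ S β D₁ D₂ D₃ ∧
      (Continuous fun p : ℝ × ℝ => X p.1 p.2) ∧ (∀ z, X 0 z = z) ∧
      (∀ t ∈ Icc 0 T, Function.Surjective (X t)) ∧
      (∀ t ∈ Icc 0 T, ∀ z, u t (X t z) = S t z ^ 6) ∧
      ∀ t ∈ Ioo 0 T, ∀ z, 0 < u₀ z → HasDerivAt (fun t => X t z)
        (6 / 5 * S t z ^ 19 * D₂ t z + 78 / 25 * S t z ^ 14 * D₁ t z ^ 2 + μ * S t z ^ 12) t := by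
  have hT0 : (0 : ℝ) ∈ Icc 0 T := ⟨le_rfl, hT.le⟩
  have hu₀ : ∀ z, 0 ≤ u₀ z := fun z => hu.initial z ▸ hu.nonneg 0 hT0 z
  set h : ℕ → ℝ → ℝ → ℝ := fun j t x => iteratedDeriv j (fun y => u t y ^ 2) x with hh
  have hcont : ∀ j ≤ 3, Continuous fun p : ℝ × ℝ => h j (clampTime T p.1) p.2 := fun j hj =>
    hsq.continuous_clampTime hT.le hj
  have hder : ∀ j < 3, ∀ t ∈ Icc 0 T, ∀ x, HasDerivAt (h j t) (h (j + 1) t x) x :=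
    fun j hj t ht x => hsq.hasDerivAt hj ht x
  have hvel : ∀ t, velocity μ u t = fun x => 1 / 2 * h 2 t x + μ * h 0 t x := fun t => by
    funext x; simp [hh, velocity]
  have hbd : ∀ j ≤ 3, ∃ C, ∀ t ∈ Icc 0 T, ∀ x, |h j t x| ≤ C := fun j hj => hsq.exists_bound hj
  obtain ⟨C0, hC0⟩ := hbd 0 (by norm_num)
  obtain ⟨C1, hC1⟩ := hbd 1 (by norm_num)
  obtain ⟨C2, hC2⟩ := hbd 2 (by norm_num)
  obtain ⟨C3, hC3⟩ := hbd 3 (by norm_num)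
  have hcomb : ∀ (a b A B : ℝ), |a| ≤ A → |b| ≤ B → |1 / 2 * a + μ * b| ≤ 1 / 2 * A + |μ| * B := by
    intro a b A B ha hb
    refine (abs_add_le _ _).trans (add_le_add ?_ ?_)
    · rw [abs_mul, abs_of_pos (by norm_num : (0 : ℝ) < 1 / 2)]; linarith
    · rw [abs_mul]; exact mul_le_mul_of_nonneg_left hb (abs_nonneg μ)
  obtain ⟨X, hXc, hX0, hXt, hXb, hXz⟩ := exists_flow hT
    (B := fun t x => 1 / 2 * h 2 (clampTime T t) x + μ * h 0 (clampTime T t) x)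
    (B' := fun t x => 1 / 2 * h 3 (clampTime T t) x + μ * h 1 (clampTime T t) x)
    (((hcont 2 (by norm_num)).const_mul _).add ((hcont 0 (by norm_num)).const_mul _))
    (((hcont 3 (by norm_num)).const_mul _).add ((hcont 1 (by norm_num)).const_mul _))
    (fun t x => ((hder 2 (by norm_num) _ (clampTime_mem hT.le t) x).const_mul _).add
      ((hder 0 (by norm_num) _ (clampTime_mem hT.le t) x).const_mul _))
    (M := 1 / 2 * C2 + |μ| * C0) (K := 1 / 2 * C3 + |μ| * C1)
    (fun t x => hcomb _ _ _ _ (hC2 _ (clampTime_mem hT.le t) x) (hC0 _ (clampTime_mem hT.le t) x))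
    (fun t x => hcomb _ _ _ _ (hC3 _ (clampTime_mem hT.le t) x) (hC1 _ (clampTime_mem hT.le t) x))
  set β : ℝ → ℝ → ℝ := fun t z => 1 / 2 * h 3 (clampTime T t) (X t z) +
    μ * h 1 (clampTime T t) (X t z) with hβ
  have hβc : Continuous fun p : ℝ × ℝ => β p.1 p.2 :=
    (((hcont 3 (by norm_num)).comp (continuous_fst.prodMk hXc)).const_mul _).add
      (((hcont 1 (by norm_num)).comp (continuous_fst.prodMk hXc)).const_mul _)
  have hβK : ∀ t z, |β t z| ≤ 1 / 2 * C3 + |μ| * C1 := fun t z =>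
    hcomb _ _ _ _ (hC3 _ (clampTime_mem hT.le t) _) (hC1 _ (clampTime_mem hT.le t) _)
  set K := 1 / 2 * C3 + |μ| * C1
  have hK0 : 0 ≤ K := (abs_nonneg _).trans (hβK 0 0)
  set I : ℝ → ℝ → ℝ := fun t z => ∫ s in (0 : ℝ)..t, β s z with hI
  have hIc : Continuous fun p : ℝ × ℝ => I p.1 p.2 := by
    refine intervalIntegral.continuous_parametric_intervalIntegral_of_continuous
      (f := fun (p : ℝ × ℝ) s => β s p.2) (s := fun p => p.1) ?_ continuous_fst
    exact hβc.comp (f := fun q : (ℝ × ℝ) × ℝ => (q.2, q.1.2)) (by fun_prop)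
  have hId : ∀ t z, HasDerivAt (fun t => I t z) (β t z) t := fun t z => by
    have hc : Continuous fun s => β s z := hβc.comp (f := fun s : ℝ => (s, z)) (by fun_prop)
    exact intervalIntegral.integral_hasDerivAt_right (hc.intervalIntegrable _ _)
      (hc.stronglyMeasurableAtFilter _ _) hc.continuousAt
  have hIb : ∀ t ∈ Icc 0 T, ∀ z, |I t z| ≤ K * T := fun t ht z => by
    have := intervalIntegral.norm_integral_le_of_norm_le_const (a := 0) (b := t)
      (f := fun s => β s z) (C := K) (fun s _ => hβK s z)
    rw [sub_zero, abs_of_nonneg ht.1] at this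
    exact this.trans (mul_le_mul_of_nonneg_left ht.2 hK0)
  have hU : ∀ t ∈ Icc 0 T, ∀ z, u t (X t z) = u₀ z * Real.exp (-I t z) := by
    intro t ht z
    have hXcz : Continuous fun s => X s z := hXc.comp (f := fun s : ℝ => (s, z)) (by fun_prop)
    have := eq_of_hasDerivAt_zero (T := T) (f := fun s => u s (X s z) * Real.exp (I s z)) ?_ ?_ ht
    · simp only [hX0, hI, intervalIntegral.integral_same, Real.exp_zero, mul_one] at this
      rw [hu.initial] at this
      rw [← this, mul_assoc, ← Real.exp_add]
      simp [hI]
    · refine ContinuousOn.mul ?_ (Real.continuous_exp.comp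
        (hIc.comp (f := fun s : ℝ => (s, z)) (by fun_prop))).continuousOn
      exact hu.contDiffOn.continuousOn.comp (f := fun s => (s, X s z))
        (continuous_id.prodMk hXcz).continuousOn fun s hs => ⟨hs, mem_univ _⟩
    · intro s hs
      have hs' : s ∈ Icc 0 T := ⟨hs.1.le, hs.2.le⟩
      have hγ := hXt s hs z
      rw [clampTime_of_mem hs'] at hγ
      have hb : HasDerivAt (velocity μ u s) (β s z) (X s z) := by
        rw [hvel, hβ]
        simp only [clampTime_of_mem hs']
        exact ((hder 2 (by norm_num) _ hs' _).const_mul _).add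
          ((hder 0 (by norm_num) _ hs' _).const_mul _)
      refine ((hu.hasDerivAt_along hs (γ := fun s => X s z) (by rw [hvel]; exact hγ) hb).mul
        (hId s z).exp).congr_deriv ?_
      ring
  -- The exponential on the left is the Jacobian of the flow map.
  have hexpI : ∀ t ∈ Icc 0 T, ∀ z, 0 < u₀ z → Real.exp (I t z) = u₀ z / u t (X t z) := by
    intro t ht z hz
    rw [hU t ht z, Real.exp_neg]
    field_simp
  set S : ℝ → ℝ → ℝ := fun t z => root u₀ z * Real.exp (-I t z / 6) with hS
  have hroot : ∀ t ∈ Icc 0 T, ∀ z, S t z = root (u t) (X t z) := by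
    intro t ht z
    rw [root, hU t ht z, Real.mul_rpow (hu₀ z) (Real.exp_pos _).le, ← Real.exp_mul, hS]
    simp only [root]
    ring_nf
  have hroot' : ∀ t ∈ Icc 0 T, S t = root (u t) ∘ X t := fun t ht => funext (hroot t ht)
  have hu₀c : Continuous u₀ := by
    have := continuous_of_sq (hu.nonneg 0 hT0) (hsq.1 0 hT0).1.continuous
    exact this.congr hu.initial
  have hupos : ∀ t ∈ Icc 0 T, ∀ z, 0 < u₀ z → 0 < u t (X t z) := fun t ht z hz => by
    rw [hU t ht z]; positivity
  have hSpos : ∀ t z, 0 < u₀ z → 0 < S t z := fun t z hz =>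
    mul_pos (root_pos hz) (Real.exp_pos _)
  have hS6 : ∀ t ∈ Icc 0 T, ∀ z, S t z ^ 6 = u t (X t z) := fun t ht z => by
    rw [hroot t ht z, root_pow_six (hu.nonneg t ht _)]
  have hcomp : ∀ t ∈ Icc 0 T, ∀ z, S t z ≤ Real.exp (K * T / 6) * root u₀ z ∧
      root u₀ z ≤ Real.exp (K * T / 6) * S t z := by
    intro t ht z
    have hb := abs_le.1 (hIb t ht z)
    have hr := root_nonneg (hu₀ z)
    constructor
    · simp only [hS]
      rw [mul_comm]
      exact mul_le_mul_of_nonneg_right (Real.exp_le_exp.2 (by linarith)) hr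
    · rw [hS, mul_left_comm, ← Real.exp_add]
      refine le_mul_of_one_le_right hr (Real.one_le_exp ?_)
      linarith
  -- Eulerian orders pull back along the flow: positivity is transported, and the two scales differ
  -- by a factor of at most `exp (K T / 6)`.
  have horder : ∀ (k : ℤ) (G : ℝ → ℝ → ℝ), IsOrder (positivitySet T u)
      (fun p => root (u p.1) p.2) k (fun p => G p.1 p.2) → IsOrder (labelSet T u₀)
      (fun p => root u₀ p.2) k fun p => G p.1 (X p.1 p.2) := by
    intro k G hG
    have := hG.comp (E := labelSet T u₀) (fun p => (p.1, X p.1 p.2))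
      (fun p hp => ⟨hp.1, hupos p.1 hp.1 p.2 hp.2⟩)
    refine this.change_scale (κ := Real.exp (K * T / 6)) ?_ ?_ ?_ ?_
    · exact fun p hp => root_pos (hupos p.1 hp.1 p.2 hp.2)
    · exact fun p hp => root_pos hp.2
    · intro p hp
      simp only [Function.comp]
      rw [← hroot p.1 hp.1]
      exact (hcomp p.1 hp.1 p.2).1
    · intro p hp
      simp only [Function.comp]
      rw [← hroot p.1 hp.1]
      exact (hcomp p.1 hp.1 p.2).2
  refine ⟨X, S, β, fun t z => massD1 (u t) (X t z), fun t z => massD2 (u t) (X t z),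
    fun t z => massD3 (u t) (X t z), ?_, hXc, hX0, ?_, fun t ht z => (hS6 t ht z).symm, ?_⟩
  · constructor
    · refine ((hu₀c.rpow_const fun _ => Or.inr (by norm_num)).comp continuous_snd).mul
        (Real.continuous_exp.comp (hIc.neg.div_const 6))
    · exact hβc
    · exact ⟨K, hβK⟩
    · intro z
      simp [hS, hI]
    · exact ⟨_, Real.exp_pos _, hcomp⟩
    · intro t ht z
      refine ((((hId t z).neg.div_const 6).exp.const_mul (root u₀ z)).pow 5).congr_deriv ?_
      simp only [hS, Pi.neg_apply]
      ring
    · intro t ht z hz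
      have := dispersion_eq_velocity_deriv (hupos t ht z hz) μ
      rw [← hroot t ht z] at this
      rw [← this]
      simp only [hβ, clampTime_of_mem ht, hh]
    · intro t ht z hz
      have := (hasDerivAt_root (hu.nonneg t ht) (hsq.1 t ht).1 (hupos t ht z hz)).comp z
        (hXz t ht z)
      rw [← hroot' t ht] at this
      refine this.congr_deriv ?_
      have hSp := hSpos t z hz
      have he := hexpI t ht z hz
      simp only [hI, hβ] at he
      rw [he, ← hS6 t ht z, massD1, ← hroot t ht z]
      field_simp
    · intro t ht z hz
      refine ((hasDerivAt_massD1 (hu.nonneg t ht) (hsq.1 t ht).1 (hupos t ht z hz)).comp z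
        (hXz t ht z)).congr_deriv ?_
      have hSp := hSpos t z hz
      have he := hexpI t ht z hz
      simp only [hI, hβ] at he
      rw [he, ← hS6 t ht z, ← hroot t ht z]
      field_simp
    · intro t ht z hz
      refine ((hasDerivAt_massD2 (hu.nonneg t ht) (hsq.1 t ht).1 (hupos t ht z hz)).comp z
        (hXz t ht z)).congr_deriv ?_
      have hSp := hSpos t z hz
      have he := hexpI t ht z hz
      simp only [hI, hβ] at he
      rw [he, ← hS6 t ht z, ← hroot t ht z]
      field_simp
    · exact horder (-5) (fun t => massD1 (u t)) (isOrder_massD1 hu.nonneg hsq hpow)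
    · exact horder (-15) (fun t => massD2 (u t)) (isOrder_massD2 hu.nonneg hsq hpow)
    · exact horder (-25) (fun t => massD3 (u t)) (isOrder_massD3 hu.nonneg hsq hpow)
  · intro t ht
    exact surjective_of_abs_sub_le (hXc.comp (f := fun z : ℝ => (t, z)) (by fun_prop)) (hXb t ht)
  · intro t ht z hz
    have ht' : t ∈ Icc 0 T := ⟨ht.1.le, ht.2.le⟩
    refine (hXt t ht z).congr_deriv ?_
    rw [hroot t ht' z, ← velocity_eq_massD (hupos t ht' z hz), clampTime_of_mem ht']
    simp [hh]
-- The local energy identity for the difference of two solutions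
/-- The coefficient of `ω ω₁` in the difference of two dispersion operators. -/
noncomputable def crossCoeff (μ f f₁ g₁ g₂ σ : ℝ) : ℝ :=
  9 * f ^ 5 * g₂ + 182 / 25 * f ^ 4 * (f₁ ^ 2 + f₁ * g₁ + g₁ ^ 2) + 2 * μ * σ

/-- The mass derivative of `crossCoeff`. -/
noncomputable def crossCoeffD (μ f f₁ f₂ g₁ g₂ g₃ σ₁ : ℝ) : ℝ :=
  45 * f ^ 4 * f₁ * g₂ + 9 * f ^ 5 * g₃ +
    182 / 25 * (4 * f ^ 3 * f₁ * (f₁ ^ 2 + f₁ * g₁ + g₁ ^ 2) +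
      f ^ 4 * (2 * f₁ * f₂ + (f₂ * g₁ + f₁ * g₂) + 2 * g₁ * g₂)) + 2 * μ * σ₁

/-- The part of the energy flux that multiplies the weight. -/
noncomputable def mainFlux (μ f f₁ f₂ g g₁ g₂ σ : ℝ) : ℝ :=
  f ^ 6 * (f - g) * (f₂ - g₂) - 1 / 2 * f ^ 6 * (f₁ - g₁) ^ 2
    + 1 / 2 * (6 * f ^ 5 * f₁) * (f - g) * (f₁ - g₁)
    - 1 / 4 * (30 * f ^ 4 * f₁ ^ 2 + 6 * f ^ 5 * f₂) * (f - g) ^ 2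
    + 1 / 2 * crossCoeff μ f f₁ g₁ g₂ σ * (f - g) ^ 2

/-- The coefficient of the derivative of the weight in the remainder of the energy identity. -/
noncomputable def weightCoeff (μ f f₁ f₂ g g₁ g₂ σ : ℝ) : ℝ :=
  3 / 2 * f ^ 6 * (f₂ - g₂) + 6 * f ^ 5 * f₁ * (f₁ - g₁)
    - 1 / 4 * (30 * f ^ 4 * f₁ ^ 2 + 6 * f ^ 5 * f₂) * (f - g)
    + 1 / 2 * crossCoeff μ f f₁ g₁ g₂ σ * (f - g)

/-- The coefficient of the squared difference in the remainder of the energy identity; `q` is the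
quotient of the differences of `σ` and of `f`. -/
noncomputable def energyCoeff (μ f f₁ f₂ f₃ g g₁ g₂ g₃ σ₁ q : ℝ) : ℝ :=
  1 / 4 * (120 * f ^ 3 * f₁ ^ 3 + 90 * f ^ 4 * f₁ * f₂ + 6 * f ^ 5 * f₃)
    - 1 / 2 * crossCoeffD μ f f₁ f₂ g₁ g₂ g₃ σ₁
    + ((f ^ 5 + f ^ 4 * g + f ^ 3 * g ^ 2 + f ^ 2 * g ^ 3 + f * g ^ 4 + g ^ 5) * g₃
      + 9 * (f ^ 4 + f ^ 3 * g + f ^ 2 * g ^ 2 + f * g ^ 3 + g ^ 4) * g₁ * g₂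
      + 182 / 25 * (f ^ 3 + f ^ 2 * g + f * g ^ 2 + g ^ 3) * g₁ ^ 3 + 2 * μ * q * g₁)

/-- The local energy identity for the difference of two solutions: `w` is the density of the mass
coordinate, so that `w * f₁` is the derivative of `f` if `f₁` is its mass derivative. -/
theorem hasDerivAt_flux {μ z w f₃ g₃ σ₁ τ q ψ₁ : ℝ} {f f₁ f₂ g g₁ g₂ σ φ ψ : ℝ → ℝ}
    (hf : HasDerivAt f (w * f₁ z) z) (hf₁ : HasDerivAt f₁ (w * f₂ z) z)
    (hf₂ : HasDerivAt f₂ (w * f₃) z) (hg : HasDerivAt g (w * g₁ z) z)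
    (hg₁ : HasDerivAt g₁ (w * g₂ z) z) (hg₂ : HasDerivAt g₂ (w * g₃) z)
    (hσ : HasDerivAt σ (w * σ₁) z) (hφ : HasDerivAt φ (w * ψ z) z)
    (hψ : HasDerivAt ψ (w * ψ₁) z) (hq : σ z - τ = (f z - g z) * q) :
    HasDerivAt (fun z => φ z * mainFlux μ (f z) (f₁ z) (f₂ z) (g z) (g₁ z) (g₂ z) (σ z)
        + 1 / 2 * ψ z * (f z ^ 6 * (f z - g z) * (f₁ z - g₁ z)))
      (w * (φ z * (f z - g z) *
          ((f z ^ 6 * f₃ + 9 * f z ^ 5 * f₁ z * f₂ z + 182 / 25 * f z ^ 4 * f₁ z ^ 3 +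
            2 * μ * σ z * f₁ z) -
          (g z ^ 6 * g₃ + 9 * g z ^ 5 * g₁ z * g₂ z + 182 / 25 * g z ^ 4 * g₁ z ^ 3 +
            2 * μ * τ * g₁ z))
        - (φ z * (f z - g z) ^ 2 *
            energyCoeff μ (f z) (f₁ z) (f₂ z) f₃ (g z) (g₁ z) (g₂ z) g₃ σ₁ q
          - ψ z * (f z - g z) * weightCoeff μ (f z) (f₁ z) (f₂ z) (g z) (g₁ z) (g₂ z) (σ z)
          - 1 / 2 * ψ₁ * (f z - g z) * (f z ^ 6 * (f₁ z - g₁ z))))) z := by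
  have hω := hf.sub hg
  have hω₁ := hf₁.sub hg₁
  have hω₂ := hf₂.sub hg₂
  have hc : HasDerivAt (fun z => crossCoeff μ (f z) (f₁ z) (g₁ z) (g₂ z) (σ z))
      (w * crossCoeffD μ (f z) (f₁ z) (f₂ z) (g₁ z) (g₂ z) g₃ σ₁) z := by
    refine (((((hf.pow 5).const_mul 9).mul hg₂).add (((hf.pow 4).const_mul (182 / 25)).mul
      (((hf₁.pow 2).add (hf₁.mul hg₁)).add (hg₁.pow 2)))).add
      (hσ.const_mul (2 * μ))).congr_deriv ?_
    simp only [crossCoeffD, Pi.pow_apply, Pi.add_apply, Pi.mul_apply]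
    ring
  -- On differentiating `h1 - h2 + h3` the `ω₁²` terms cancel and `ω ω₂` gets the coefficient 6 + 3
  -- = 9 times `f⁵ f₁`. The terms `h4` and `h5` absorb the products `ω ω₁` into derivatives of `ω²`.
  have h1 := ((hf.pow 6).mul hω).mul hω₂
  have h2 := ((hf.pow 6).const_mul (1 / 2)).mul (hω₁.pow 2)
  have h3 := (((((hf.pow 5).const_mul 6).mul hf₁).const_mul (1 / 2)).mul hω).mul hω₁
  have h4 := (((((hf.pow 4).const_mul 30).mul (hf₁.pow 2)).add
    (((hf.pow 5).const_mul 6).mul hf₂)).const_mul (1 / 4)).mul (hω.pow 2)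
  have h5 := (hc.const_mul (1 / 2)).mul (hω.pow 2)
  -- This correction removes `-1/2 f⁶ ω₁² ψ`, the only term with `ψ` that lacks a factor `ω`. That
  -- factor matters: an error of size `ε φ` alone has an integral that does not tend to zero.
  have h6 := (hψ.const_mul (1 / 2)).mul (((hf.pow 6).mul hω).mul hω₁)
  refine ((hφ.mul ((((h1.sub h2).add h3).sub h4).add h5)).add h6).congr_deriv ?_
  have hτ : τ = σ z - (f z - g z) * q := by rw [← hq]; ring
  simp only [Pi.pow_apply, Pi.add_apply, Pi.mul_apply, Pi.sub_apply, energyCoeff, weightCoeff, hτ,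
    crossCoeffD, crossCoeff]
  ring

/-! ### Orders of the flux and of the remainder coefficients -/

section Bounds

variable {α : Type*} {D : Set α} {m : α → ℝ} {M : ℝ} {μ : ℝ} {f f₁ f₂ f₃ g g₁ g₂ g₃ σ σ₁ q : α → ℝ}

theorem isOrder_crossCoeff (hm : ∀ p ∈ D, 0 < m p)
    (hf : IsOrder D m 5 f) (hf₁ : IsOrder D m (-5) f₁) (hg₁ : IsOrder D m (-5) g₁)
    (hg₂ : IsOrder D m (-15) g₂) (hσ : IsOrder D m 10 σ) :
    IsOrder D m 10 fun p => crossCoeff μ (f p) (f₁ p) (g₁ p) (g₂ p) (σ p) := by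
  have h1 := (((hf.pow hm 5).const_mul 9).mul hm hg₂).congr_order (l := 10) (by norm_num)
  have h2 := (((hf.pow hm 4).const_mul (182 / 25)).mul hm
    (((hf₁.pow hm 2).add ((hf₁.mul hm hg₁).congr_order (by norm_num))).add (hg₁.pow hm 2))
    ).congr_order (l := 10) (by norm_num)
  exact (h1.add h2).add (hσ.const_mul (2 * μ))

theorem isOrder_mainFlux (hm : ∀ p ∈ D, 0 < m p)
    (hf : IsOrder D m 5 f) (hf₁ : IsOrder D m (-5) f₁) (hf₂ : IsOrder D m (-15) f₂)
    (hg : IsOrder D m 5 g) (hg₁ : IsOrder D m (-5) g₁) (hg₂ : IsOrder D m (-15) g₂)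
    (hσ : IsOrder D m 10 σ) :
    IsOrder D m 20 fun p => mainFlux μ (f p) (f₁ p) (f₂ p) (g p) (g₁ p) (g₂ p) (σ p) := by
  have hω := hf.sub hg
  have hω₁ := hf₁.sub hg₁
  have hω₂ := hf₂.sub hg₂
  have h1 := (((hf.pow hm 6).mul hm hω).mul hm hω₂).congr_order (l := 20) (by norm_num)
  have h2 := (((hf.pow hm 6).const_mul (1 / 2)).mul hm (hω₁.pow hm 2)).congr_order (l := 20)
    (by norm_num)
  have h3 := ((((((hf.pow hm 5).const_mul 6).mul hm hf₁).const_mul (1 / 2)).mul hm hω).mul hm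
    hω₁).congr_order (l := 20) (by norm_num)
  have h4 := (((((((hf.pow hm 4).const_mul 30).mul hm (hf₁.pow hm 2)).congr_order (l := 10)
    (by norm_num)).add ((((hf.pow hm 5).const_mul 6).mul hm hf₂).congr_order (by norm_num))
    ).const_mul (1 / 4)).mul hm (hω.pow hm 2)).congr_order (l := 20) (by norm_num)
  have h5 := (((isOrder_crossCoeff (μ := μ) hm hf hf₁ hg₁ hg₂ hσ).const_mul (1 / 2)).mul hm
    (hω.pow hm 2)).congr_order (l := 20) (by norm_num)
  exact (((h1.sub h2).add h3).sub h4).add h5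

theorem isOrder_weightCoeff (hm : ∀ p ∈ D, 0 < m p)
    (hf : IsOrder D m 5 f) (hf₁ : IsOrder D m (-5) f₁) (hf₂ : IsOrder D m (-15) f₂)
    (hg : IsOrder D m 5 g) (hg₁ : IsOrder D m (-5) g₁) (hg₂ : IsOrder D m (-15) g₂)
    (hσ : IsOrder D m 10 σ) :
    IsOrder D m 15 fun p => weightCoeff μ (f p) (f₁ p) (f₂ p) (g p) (g₁ p) (g₂ p) (σ p) := by
  have hω := hf.sub hg
  have hω₁ := hf₁.sub hg₁
  have hω₂ := hf₂.sub hg₂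
  have h1 := (((hf.pow hm 6).const_mul (3 / 2)).mul hm hω₂).congr_order (l := 15) (by norm_num)
  have h2 := ((((hf.pow hm 5).const_mul 6).mul hm hf₁).mul hm hω₁).congr_order (l := 15)
    (by norm_num)
  have h4 := (((((((hf.pow hm 4).const_mul 30).mul hm (hf₁.pow hm 2)).congr_order (l := 10)
    (by norm_num)).add ((((hf.pow hm 5).const_mul 6).mul hm hf₂).congr_order (by norm_num))
    ).const_mul (1 / 4)).mul hm hω).congr_order (l := 15) (by norm_num)
  have h5 := (((isOrder_crossCoeff (μ := μ) hm hf hf₁ hg₁ hg₂ hσ).const_mul (1 / 2)).mul hm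
    hω).congr_order (l := 15) (by norm_num)
  exact ((h1.add h2).sub h4).add h5

theorem isOrder_crossCoeffD (hm : ∀ p ∈ D, 0 < m p)
    (hf : IsOrder D m 5 f) (hf₁ : IsOrder D m (-5) f₁) (hf₂ : IsOrder D m (-15) f₂)
    (hg₁ : IsOrder D m (-5) g₁) (hg₂ : IsOrder D m (-15) g₂)
    (hg₃ : IsOrder D m (-25) g₃) (hσ₁ : IsOrder D m 0 σ₁) :
    IsOrder D m 0 fun p =>
      crossCoeffD μ (f p) (f₁ p) (f₂ p) (g₁ p) (g₂ p) (g₃ p) (σ₁ p) := by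
  have h1 := ((((hf.pow hm 4).const_mul 45).mul hm hf₁).mul hm hg₂).congr_order (l := 0)
    (by norm_num)
  have h2 := (((hf.pow hm 5).const_mul 9).mul hm hg₃).congr_order (l := 0) (by norm_num)
  have h3 := ((((hf.pow hm 3).const_mul 4).mul hm hf₁).mul hm
    (((hf₁.pow hm 2).add ((hf₁.mul hm hg₁).congr_order (by norm_num))).add (hg₁.pow hm 2))
    ).congr_order (l := 0) (by norm_num)
  have h4 := ((hf.pow hm 4).mul hm ((((hf₁.const_mul 2).mul hm hf₂).add
    (((hf₂.mul hm hg₁).congr_order (by norm_num)).add (hf₁.mul hm hg₂))).add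
    ((hg₁.const_mul 2).mul hm hg₂))).congr_order (l := 0) (by norm_num)
  exact ((h1.add h2).add ((h3.add h4).const_mul (182 / 25))).add (hσ₁.const_mul (2 * μ))

/-- The count is exact for the dispersive terms: with orders 5, -5, -15, -25 the products `f⁵ f₃`,
`f⁴ f₁ f₂` and `f³ f₁³` all have order 0, so no power of the scale is to spare. -/
theorem isOrder_energyCoeff (hm : ∀ p ∈ D, 0 < m p)
    (hf : IsOrder D m 5 f) (hf₁ : IsOrder D m (-5) f₁) (hf₂ : IsOrder D m (-15) f₂)
    (hf₃ : IsOrder D m (-25) f₃) (hg : IsOrder D m 5 g) (hg₁ : IsOrder D m (-5) g₁)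
    (hg₂ : IsOrder D m (-15) g₂) (hg₃ : IsOrder D m (-25) g₃) (hσ₁ : IsOrder D m 0 σ₁)
    (hq : IsOrder D m 5 q) :
    IsOrder D m 0 fun p => energyCoeff μ (f p) (f₁ p) (f₂ p) (f₃ p) (g p) (g₁ p) (g₂ p) (g₃ p)
      (σ₁ p) (q p) := by
  have e : ∀ (i j n : ℕ), i + j = n →
      IsOrder D m (n * 5) fun p => f p ^ i * g p ^ j := fun i j n h =>
    ((hf.pow hm i).mul hm (hg.pow hm j)).congr_order (by rw [← h]; push_cast; ring)
  have h1 := ((((hf.pow hm 3).const_mul 120).mul hm (hf₁.pow hm 3)).congr_order (l := 0)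
    (by norm_num)).add (((((hf.pow hm 4).const_mul 90).mul hm hf₁).mul hm hf₂).congr_order
    (by norm_num))
  have h2 := h1.add ((((hf.pow hm 5).const_mul 6).mul hm hf₃).congr_order (by norm_num))
  have h3 := isOrder_crossCoeffD (μ := μ) hm hf hf₁ hf₂ hg₁ hg₂ hg₃ hσ₁
  have h4 := ((((((((e 5 0 5 rfl).add (e 4 1 5 rfl)).add (e 3 2 5 rfl)).add (e 2 3 5 rfl)).add
    (e 1 4 5 rfl)).add (e 0 5 5 rfl)).mul hm hg₃)).congr_order (l := 0) (by norm_num)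
  have h5 := (((((((e 4 0 4 rfl).add (e 3 1 4 rfl)).add (e 2 2 4 rfl)).add (e 1 3 4 rfl)).add
    (e 0 4 4 rfl)).const_mul 9).mul hm (hg₁.mul hm hg₂)).congr_order (l := 0) (by norm_num)
  have h6 := ((((((e 3 0 3 rfl).add (e 2 1 3 rfl)).add (e 1 2 3 rfl)).add
    (e 0 3 3 rfl)).const_mul (182 / 25)).mul hm (hg₁.pow hm 3)).congr_order (l := 0) (by norm_num)
  have h7 := ((hq.const_mul (2 * μ)).mul hm hg₁).congr_order (l := 0) (by norm_num)
  refine (((h2.const_mul (1 / 4)).sub (h3.const_mul (1 / 2))).add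
    (((h4.add h5).add h6).add h7)).congr fun p _ => ?_
  simp only [energyCoeff]
  ring

end Bounds

/-- The quotient of the differences of eighteenth and of fifth powers. -/
noncomputable def powQuotient (s r : ℝ) : ℝ :=
  (∑ i ∈ Finset.range 18, s ^ i * r ^ (17 - i)) / ∑ i ∈ Finset.range 5, s ^ i * r ^ (4 - i)

/-- The energy is built on `s⁵`, and `s¹⁸` is not a polynomial in it; this quotient exhibits the
factor `ω` in the difference of the `μ` terms. -/
theorem pow_sub_pow_eq_mul_powQuotient {s r : ℝ} (hs : 0 < s) (hr : 0 < r) :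
    s ^ 18 - r ^ 18 = (s ^ 5 - r ^ 5) * powQuotient s r := by
  have h : 0 < ∑ i ∈ Finset.range 5, s ^ i * r ^ (4 - i) :=
    Finset.sum_pos (fun i _ => by positivity) (by simp)
  rw [powQuotient, ← (Commute.all s r).geom_sum₂_mul 18, ← (Commute.all s r).geom_sum₂_mul 5]
  field_simp

theorem isOrder_powQuotient {α : Type*} {D : Set α} {m s r : α → ℝ} {κ : ℝ}
    (hm : ∀ p ∈ D, 0 < m p) (hs : IsOrder D m 1 s) (hr : IsOrder D m 1 r)
    (hr0 : ∀ p ∈ D, 0 < r p) (hs0 : ∀ p ∈ D, 0 < s p) (hms : ∀ p ∈ D, m p ≤ κ * s p) :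
    IsOrder D m 13 fun p => powQuotient (s p) (r p) := by
  have hnum : ∀ n ≤ 18, IsOrder D m 17 fun p => ∑ i ∈ Finset.range n, s p ^ i * r p ^ (17 - i) := by
    intro n
    induction n with
    | zero => exact fun _ => ⟨0, by simp⟩
    | succ n ih =>
      intro hn
      refine ((ih (by omega)).add (((hs.pow hm n).mul hm (hr.pow hm (17 - n))).congr_order
        (l := 17) ?_)).congr fun p _ => Finset.sum_range_succ _ _
      push_cast [show n ≤ 17 by omega]
      ring
  have hden : IsOrder D m (-4) fun p => (∑ i ∈ Finset.range 5, s p ^ i * r p ^ (4 - i))⁻¹ := by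
    refine IsOrder.of_abs_mul_pow_le hm (C := κ ^ 4) 4 fun p hp => ?_
    have h1 := hs0 p hp
    have h2 := hr0 p hp
    have h3 : s p ^ 4 ≤ ∑ i ∈ Finset.range 5, s p ^ i * r p ^ (4 - i) := by
      have := Finset.single_le_sum (f := fun i => s p ^ i * r p ^ (4 - i))
        (fun i _ => by positivity) (Finset.mem_range.2 (by norm_num : 4 < 5))
      rwa [Nat.sub_self, pow_zero, mul_one] at this
    have h4 : 0 < s p ^ 4 := by positivity
    rw [abs_of_pos (inv_pos.2 (h4.trans_le h3)), inv_mul_eq_div, div_le_iff₀ (h4.trans_le h3)]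
    calc m p ^ 4 ≤ (κ * s p) ^ 4 := pow_le_pow_left₀ (hm p hp).le (hms p hp) 4
      _ = κ ^ 4 * s p ^ 4 := mul_pow _ _ _
      _ ≤ _ := mul_le_mul_of_nonneg_left h3 (by positivity)
  exact (((hnum 18 le_rfl).mul hm hden).congr_order (by norm_num)).congr fun p _ =>
    div_eq_mul_inv _ _
theorem IsOrder.abs {α : Type*} {D : Set α} {m : α → ℝ} {k : ℤ} {f : α → ℝ}
    (hf : IsOrder D m k f) : IsOrder D m k fun p => |f p| := by
  obtain ⟨C, hC⟩ := hf
  exact ⟨C, fun p hp => by rw [abs_abs]; exact hC p hp⟩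

theorem IsOrder.exists_bound {α : Type*} {D : Set α} {m : α → ℝ} {k : ℤ} {f : α → ℝ}
    (hm : ∀ p ∈ D, 0 < m p) {M : ℝ} (hM : ∀ p ∈ D, m p ≤ M) (hk : 0 ≤ k)
    (hf : IsOrder D m k f) : ∃ C, ∀ p ∈ D, |f p| ≤ C := by
  obtain ⟨C, hC⟩ := hf.mono_order hm hM hk
  exact ⟨C, fun p hp => by simpa using hC p hp⟩

/-! ### A slowly varying integrable weight -/

/-- The weight `1 / (1 + ε² z²)`. -/
noncomputable def weight (ε z : ℝ) : ℝ := (1 + (ε * z) ^ 2)⁻¹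

/-- The derivative of `weight ε`. -/
noncomputable def weightD1 (ε z : ℝ) : ℝ := -(2 * ε ^ 2 * z) * weight ε z ^ 2

/-- The second derivative of `weight ε`. -/
noncomputable def weightD2 (ε z : ℝ) : ℝ :=
  -(2 * ε ^ 2) * weight ε z ^ 2 + 8 * ε ^ 4 * z ^ 2 * weight ε z ^ 3

theorem weight_pos (ε z : ℝ) : 0 < weight ε z := by unfold weight; positivity

theorem weight_le_one (ε z : ℝ) : weight ε z ≤ 1 :=
  inv_le_one_of_one_le₀ (by nlinarith [sq_nonneg (ε * z)])

theorem continuous_weight (ε : ℝ) : Continuous (weight ε) := by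
  unfold weight
  exact Continuous.inv₀ (by fun_prop) fun z => by positivity

theorem hasDerivAt_weight (ε z : ℝ) : HasDerivAt (weight ε) (weightD1 ε z) z := by
  have h : HasDerivAt (fun z : ℝ => 1 + (ε * z) ^ 2) (2 * ε ^ 2 * z) z :=
    ((((hasDerivAt_id z).const_mul ε).pow 2).const_add 1).congr_deriv (by simp; ring)
  refine (h.inv (by positivity)).congr_deriv ?_
  rw [weightD1, weight]
  field_simp

theorem hasDerivAt_weightD1 (ε z : ℝ) : HasDerivAt (weightD1 ε) (weightD2 ε z) z := by
  have h : HasDerivAt (fun z : ℝ => -(2 * ε ^ 2 * z)) (-(2 * ε ^ 2)) z :=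
    ((hasDerivAt_id z).const_mul (2 * ε ^ 2)).neg.congr_deriv (by simp)
  refine (h.mul ((hasDerivAt_weight ε z).pow 2)).congr_deriv ?_
  simp only [Pi.pow_apply, weightD1, weightD2]
  ring

/-- Derivatives controlled by a small multiple of the weight itself let the commutator errors be
absorbed into the weighted energy. -/
theorem abs_weightD1_le {ε : ℝ} (hε : 0 < ε) (z : ℝ) : |weightD1 ε z| ≤ ε * weight ε z := by
  have hw := weight_pos ε z
  have h1 : weight ε z * (1 + (ε * z) ^ 2) = 1 := inv_mul_cancel₀ (by positivity)
  have h2 : |2 * (ε * z)| ≤ 1 + (ε * z) ^ 2 := by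
    rw [abs_le]; constructor <;> nlinarith [sq_nonneg (ε * z - 1), sq_nonneg (ε * z + 1)]
  calc |weightD1 ε z| = ε * weight ε z * (weight ε z * |2 * (ε * z)|) := by
        rw [show weightD1 ε z = -(ε * weight ε z * (weight ε z * (2 * (ε * z)))) by
          rw [weightD1]; ring, abs_neg, abs_mul, abs_mul (weight ε z), abs_of_pos hw,
          abs_of_pos (mul_pos hε hw)]
    _ ≤ ε * weight ε z * (weight ε z * (1 + (ε * z) ^ 2)) := by gcongr
    _ = _ := by rw [h1, mul_one]

theorem abs_weightD2_le {ε : ℝ} (hε : 0 < ε) (hε1 : ε ≤ 1) (z : ℝ) :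
    |weightD2 ε z| ≤ 10 * ε * weight ε z := by
  have hw := weight_pos ε z
  have hw1 := weight_le_one ε z
  have h1 : weight ε z * (1 + (ε * z) ^ 2) = 1 := inv_mul_cancel₀ (by positivity)
  have h2 : weight ε z * (ε * z) ^ 2 ≤ 1 := by nlinarith
  have h2' : 0 ≤ weight ε z * (ε * z) ^ 2 := by positivity
  have h3 : weightD2 ε z =
      ε ^ 2 * weight ε z * (weight ε z * (8 * (weight ε z * (ε * z) ^ 2) - 2)) := by
    rw [weightD2]; ring
  have h4 : |weight ε z * (8 * (weight ε z * (ε * z) ^ 2) - 2)| ≤ 10 := by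
    rw [abs_mul, abs_of_pos hw]
    have : |8 * (weight ε z * (ε * z) ^ 2) - 2| ≤ 10 := by
      rw [abs_le]; constructor <;> linarith
    calc _ ≤ 1 * 10 := mul_le_mul hw1 this (abs_nonneg _) zero_le_one
      _ = 10 := by norm_num
  rw [h3, abs_mul, abs_of_pos (by positivity)]
  have h5 : ε ^ 2 ≤ ε := by nlinarith
  calc ε ^ 2 * weight ε z * _ ≤ ε * weight ε z * 10 := by gcongr
    _ = _ := by ring

theorem integrable_weight {ε : ℝ} (hε : 0 < ε) : MeasureTheory.Integrable (weight ε) :=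
  integrable_inv_one_add_sq.comp_mul_left' hε.ne'

theorem integral_weight {ε : ℝ} (hε : 0 < ε) : ∫ z, weight ε z = Real.pi / ε := by
  have := MeasureTheory.Measure.integral_comp_mul_left (fun x : ℝ => (1 + x ^ 2)⁻¹) ε
  rw [integral_univ_inv_one_add_sq, abs_of_pos (inv_pos.2 hε), smul_eq_mul] at this
  rw [div_eq_inv_mul, ← this]
  rfl

/-! ### The energy flux on the whole line -/

section Energy

variable {μ T : ℝ} {u₀ : ℝ → ℝ} {S β D₁ D₂ D₃ R γ E₁ E₂ E₃ : ℝ → ℝ → ℝ}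

theorem root_pos_of_mem_labelSet : ∀ p ∈ labelSet T u₀, 0 < root u₀ p.2 := fun _ hp => root_pos hp.2

theorem root_le {M : ℝ} (hu₀ : ∀ z, 0 ≤ u₀ z) (hM : ∀ z, u₀ z ≤ M) (z : ℝ) :
    root u₀ z ≤ M ^ (1 / 6 : ℝ) := Real.rpow_le_rpow (hu₀ z) (hM z) (by norm_num)

namespace IsLagrangianSolution

variable (hS : IsLagrangianSolution μ T u₀ S β D₁ D₂ D₃)
include hS

theorem S_nonneg (hu₀ : ∀ z, 0 ≤ u₀ z) {t : ℝ} (ht : t ∈ Icc 0 T) (z : ℝ) : 0 ≤ S t z := by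
  obtain ⟨κ, hκ, h⟩ := hS.comparable
  have := (root_nonneg (hu₀ z)).trans (h t ht z).2
  exact nonneg_of_mul_nonneg_right this hκ

theorem S_pos {t z : ℝ} (ht : t ∈ Icc 0 T) (hz : 0 < u₀ z) : 0 < S t z := by
  obtain ⟨κ, hκ, h⟩ := hS.comparable
  exact pos_of_mul_pos_right ((root_pos hz).trans_le (h t ht z).2) hκ.le

theorem S_eq_zero (hu₀ : ∀ z, 0 ≤ u₀ z) {t z : ℝ} (ht : t ∈ Icc 0 T) (hz : u₀ z = 0) :
    S t z = 0 := by
  obtain ⟨κ, hκ, h⟩ := hS.comparable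
  have h1 := (h t ht z).1
  have h2 : root u₀ z = 0 := by rw [root, hz, Real.zero_rpow (by norm_num)]
  rw [h2, mul_zero] at h1
  exact le_antisymm h1 (hS.S_nonneg hu₀ ht z)

theorem exists_bound_S {M : ℝ} (hu₀ : ∀ z, 0 ≤ u₀ z) (hM : ∀ z, u₀ z ≤ M) :
    ∃ C, ∀ t ∈ Icc 0 T, ∀ z, |S t z| ≤ C := by
  obtain ⟨κ, hκ, h⟩ := hS.comparable
  refine ⟨κ * M ^ (1 / 6 : ℝ), fun t ht z => ?_⟩
  rw [abs_of_nonneg (hS.S_nonneg hu₀ ht z)]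
  exact (h t ht z).1.trans (mul_le_mul_of_nonneg_left (root_le hu₀ hM z) hκ.le)

theorem order_S (hu₀ : ∀ z, 0 ≤ u₀ z) :
    IsOrder (labelSet T u₀) (fun p => root u₀ p.2) 1 fun p => S p.1 p.2 := by
  obtain ⟨κ, hκ, h⟩ := hS.comparable
  refine ⟨κ, fun p hp => ?_⟩
  rw [abs_of_nonneg (hS.S_nonneg hu₀ hp.1 p.2), zpow_one]
  exact (h p.1 hp.1 p.2).1

theorem order_pow (hu₀ : ∀ z, 0 ≤ u₀ z) :
    IsOrder (labelSet T u₀) (fun p => root u₀ p.2) 5 fun p => S p.1 p.2 ^ 5 :=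
  ((hS.order_S hu₀).pow root_pos_of_mem_labelSet 5).congr_order (by norm_num)

theorem hasDerivAt_pow {t z : ℝ} (ht : t ∈ Icc 0 T) (hz : 0 < u₀ z) :
    HasDerivAt (fun z => S t z ^ 5) (u₀ z * D₁ t z) z := by
  have hs := hS.S_pos ht hz
  refine ((hS.hasDerivAt_S t ht z hz).pow 5).congr_deriv ?_
  field_simp
  push_cast
  ring

theorem hasDerivAt_pow_eighteen {t z : ℝ} (ht : t ∈ Icc 0 T) (hz : 0 < u₀ z) :
    HasDerivAt (fun z => S t z ^ 18) (u₀ z * (18 / 5 * S t z ^ 13 * D₁ t z)) z := by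
  have hs := hS.S_pos ht hz
  refine ((hS.hasDerivAt_S t ht z hz).pow 18).congr_deriv ?_
  field_simp
  push_cast
  ring

theorem hasDerivAt_initial (hT : 0 ≤ T) (hu₀ : ∀ z, 0 ≤ u₀ z) {z : ℝ} (hz : 0 < u₀ z) :
    HasDerivAt u₀ (6 / 5 * root u₀ z ^ 7 * D₁ 0 z) z := by
  have hr := root_pos hz
  have h := (hS.hasDerivAt_S 0 ⟨le_rfl, hT⟩ z hz).pow 6
  have h1 : S 0 ^ 6 = u₀ := funext fun y => by
    rw [Pi.pow_apply, hS.initial, root_pow_six (hu₀ y)]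
  rw [h1] at h
  refine h.congr_deriv ?_
  rw [hS.initial, ← root_pow_six hz.le]
  field_simp
  push_cast
  ring

end IsLagrangianSolution

set_option maxHeartbeats 1600000 in
/-- At a fixed time, the energy production is a total derivative up to lower order terms. -/
theorem exists_flux (hT : 0 ≤ T) (hS : IsLagrangianSolution μ T u₀ S β D₁ D₂ D₃)
    (hR : IsLagrangianSolution μ T u₀ R γ E₁ E₂ E₃) (hu₀ : ∀ z, 0 ≤ u₀ z)
    (hd : Differentiable ℝ u₀) {M : ℝ} (hM : ∀ z, u₀ z ≤ M) :
    ∃ C ≥ 0, ∀ ε > 0, ε ≤ 1 → ∀ t ∈ Icc 0 T, ∃ F F' : ℝ → ℝ, (∀ z, HasDerivAt F (F' z) z) ∧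
      (∀ z, |F z| ≤ C * weight ε z) ∧
      ∀ z, |F' z - u₀ z * (weight ε z * (S t z ^ 5 - R t z ^ 5) *
          (5 / 6 * S t z ^ 5 * β t z - 5 / 6 * R t z ^ 5 * γ t z))| ≤
        C * (u₀ z * (weight ε z * ((S t z ^ 5 - R t z ^ 5) ^ 2 +
          ε * |S t z ^ 5 - R t z ^ 5|))) := by
  set D := labelSet T u₀
  set m : ℝ × ℝ → ℝ := fun p => root u₀ p.2
  have hm : ∀ p ∈ D, 0 < m p := root_pos_of_mem_labelSet
  have hmM : ∀ p ∈ D, m p ≤ M ^ (1 / 6 : ℝ) := fun p _ => root_le hu₀ hM p.2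
  have hs := hS.order_S hu₀
  have hr := hR.order_S hu₀
  have hf := hS.order_pow hu₀
  have hg := hR.order_pow hu₀
  -- The true order is 18; it may be lowered since `u₀` is bounded.
  have hσ : IsOrder D m 10 fun p => S p.1 p.2 ^ 18 :=
    (hs.pow hm 18).mono_order hm hmM (by norm_num)
  have hσ₁ : IsOrder D m 0 fun p => 18 / 5 * S p.1 p.2 ^ 13 * D₁ p.1 p.2 :=
    (((hs.pow hm 13).const_mul (18 / 5)).mul hm hS.order_D₁).mono_order hm hmM (by norm_num)
  obtain ⟨κ, hκ, hκS⟩ := hS.comparable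
  have hq : IsOrder D m 5 fun p => powQuotient (S p.1 p.2) (R p.1 p.2) :=
    (isOrder_powQuotient hm hs hr (fun p hp => hR.S_pos hp.1 hp.2)
      (fun p hp => hS.S_pos hp.1 hp.2) (fun p hp => (hκS p.1 hp.1 p.2).2)).mono_order hm hmM
      (by norm_num)
  have hd0 : IsOrder D m (-5) fun p => D₁ 0 p.2 :=
    hS.order_D₁.comp (E := D) (fun p : ℝ × ℝ => ((0 : ℝ), p.2))
      fun p (hp : p ∈ labelSet T u₀) => ⟨⟨le_rfl, hT⟩, hp.2⟩
  have hx := ((hf.pow hm 6).mul hm (hS.order_D₁.sub hR.order_D₁))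
  obtain ⟨C₁, hC₁⟩ := (isOrder_energyCoeff (μ := μ) hm hf hS.order_D₁ hS.order_D₂ hS.order_D₃ hg
    hR.order_D₁ hR.order_D₂ hR.order_D₃ hσ₁ hq).exists_bound hm hmM le_rfl
  -- The first mass derivative of the weight costs `u₀⁻¹ = m⁻⁶`, leaving order 15 - 6 = 9. In `C₃`
  -- the second one costs at most `m⁻¹⁶`, against order 25 of `f⁶ ω₁`.
  obtain ⟨C₂, hC₂⟩ := ((isOrder_weightCoeff (μ := μ) hm hf hS.order_D₁ hS.order_D₂ hg hR.order_D₁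
    hR.order_D₂ hσ).div_scale_pow hm 6).exists_bound hm hmM (by norm_num)
  obtain ⟨C₃, hC₃⟩ := ((((((IsOrder.scale_zpow hm 0).const_mul 10).div_scale_pow hm 12).mono_order
    (l := -16) hm hmM (by norm_num)).add (((((((IsOrder.scale hm).pow hm 7).const_mul (6 / 5)).mul
    hm hd0).abs).div_scale_pow hm 18).congr_order (l := -16) (by norm_num))).mul hm
    hx).exists_bound hm hmM (by norm_num)
  obtain ⟨C₄, hC₄⟩ := ((isOrder_mainFlux (μ := μ) hm hf hS.order_D₁ hS.order_D₂ hg hR.order_D₁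
    hR.order_D₂ hσ).div_scale_pow hm 6).exists_bound hm hmM (by norm_num)
  obtain ⟨C₅, hC₅⟩ := ((((hf.pow hm 6).mul hm (hf.sub hg)).mul hm
    (hS.order_D₁.sub hR.order_D₁)).div_scale_pow hm 12).exists_bound hm hmM (by norm_num)
  set C := |C₁| + |C₂| + |C₃| with hC
  set C' := |C₄| + |C₅| with hC'
  have hM0 : 0 ≤ M := (hu₀ 0).trans (hM 0)
  refine ⟨C + C' * M, by positivity, fun ε hε hε1 t ht => ?_⟩
  set G : ℝ → ℝ := fun z => weight ε z * mainFlux μ (S t z ^ 5) (D₁ t z) (D₂ t z) (R t z ^ 5)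
      (E₁ t z) (E₂ t z) (S t z ^ 18) + 1 / 2 * (weightD1 ε z / u₀ z) *
      ((S t z ^ 5) ^ 6 * (S t z ^ 5 - R t z ^ 5) * (D₁ t z - E₁ t z)) with hG
  -- The second mass derivative of the weight, with `u₀'` expressed through `D₁` at time 0; its
  -- order 7 - 5 = 2 makes `u₀' / u₀³` of order -16.
  set ψ₁ : ℝ → ℝ := fun z => (weightD2 ε z * u₀ z - weightD1 ε z *
    (6 / 5 * root u₀ z ^ 7 * D₁ 0 z)) / u₀ z ^ 3 with hψ₁
  set rem : ℝ → ℝ := fun z => weight ε z * (S t z ^ 5 - R t z ^ 5) ^ 2 *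
      energyCoeff μ (S t z ^ 5) (D₁ t z) (D₂ t z) (D₃ t z) (R t z ^ 5) (E₁ t z) (E₂ t z) (E₃ t z)
        (18 / 5 * S t z ^ 13 * D₁ t z) (powQuotient (S t z) (R t z))
    - weightD1 ε z / u₀ z * (S t z ^ 5 - R t z ^ 5) * weightCoeff μ (S t z ^ 5) (D₁ t z) (D₂ t z)
        (R t z ^ 5) (E₁ t z) (E₂ t z) (S t z ^ 18)
    - 1 / 2 * ψ₁ z * (S t z ^ 5 - R t z ^ 5) * ((S t z ^ 5) ^ 6 * (D₁ t z - E₁ t z)) with hrem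
  set prod : ℝ → ℝ := fun z => weight ε z * (S t z ^ 5 - R t z ^ 5) *
    (5 / 6 * S t z ^ 5 * β t z - 5 / 6 * R t z ^ 5 * γ t z) with hprod
  have hGd : ∀ z, 0 < u₀ z → HasDerivAt G (u₀ z * (prod z - rem z)) z := by
    intro z hz
    have hu' := hS.hasDerivAt_initial hT hu₀ hz
    have := hasDerivAt_flux (μ := μ) (w := u₀ z) (f₃ := D₃ t z) (g₃ := E₃ t z)
      (ψ₁ := ψ₁ z) (ψ := fun z => weightD1 ε z / u₀ z) (φ := weight ε)
      (hS.hasDerivAt_pow ht hz) (hS.hasDerivAt_D₁ t ht z hz) (hS.hasDerivAt_D₂ t ht z hz)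
      (hR.hasDerivAt_pow ht hz) (hR.hasDerivAt_D₁ t ht z hz) (hR.hasDerivAt_D₂ t ht z hz)
      (hS.hasDerivAt_pow_eighteen ht hz)
      ((hasDerivAt_weight ε z).congr_deriv (by field_simp))
      (((hasDerivAt_weightD1 ε z).div hu' hz.ne').congr_deriv (by
        rw [hψ₁]; field_simp))
      (pow_sub_pow_eq_mul_powQuotient (hS.S_pos ht hz) (hR.S_pos ht hz))
    refine this.congr_deriv ?_
    simp only [hprod, hrem]
    rw [hS.evolution t ht z hz, hR.evolution t ht z hz]
    rfl
  have hψ : ∀ z, 0 < u₀ z → |weightD1 ε z / u₀ z| ≤ ε * weight ε z * (root u₀ z ^ 6)⁻¹ := by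
    intro z hz
    rw [abs_div, abs_of_pos hz, root_pow_six hz.le, div_eq_mul_inv]
    exact mul_le_mul_of_nonneg_right (abs_weightD1_le hε z) (inv_nonneg.2 hz.le)
  have hψ₁b : ∀ z, 0 < u₀ z → |ψ₁ z| ≤ ε * weight ε z *
      (10 / root u₀ z ^ 12 + |6 / 5 * root u₀ z ^ 7 * D₁ 0 z| / root u₀ z ^ 18) := by
    intro z hz
    have hr := root_pos hz
    have h1 := abs_weightD1_le hε z
    have h2 := abs_weightD2_le hε hε1 z
    simp only [hψ₁]
    rw [abs_div, abs_of_pos (pow_pos hz 3), div_le_iff₀ (pow_pos hz 3)]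
    have h3 : |weightD2 ε z * u₀ z - weightD1 ε z * (6 / 5 * root u₀ z ^ 7 * D₁ 0 z)| ≤
        10 * ε * weight ε z * u₀ z +
          ε * weight ε z * |6 / 5 * root u₀ z ^ 7 * D₁ 0 z| := by
      refine (abs_sub _ _).trans ?_
      rw [abs_mul, abs_mul (weightD1 ε z), abs_of_pos hz]
      gcongr
    refine h3.trans (le_of_eq ?_)
    rw [← root_pow_six hz.le]
    field_simp
  have hremb : ∀ z, 0 < u₀ z → |rem z| ≤ C * (weight ε z * ((S t z ^ 5 - R t z ^ 5) ^ 2 +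
      ε * |S t z ^ 5 - R t z ^ 5|)) := by
    intro z hz
    have hr := root_pos hz
    have hw := weight_pos ε z
    have hp : (t, z) ∈ D := ⟨ht, hz⟩
    have b1 := hC₁ _ hp
    have b2 := hC₂ _ hp
    have b3 := hC₃ _ hp
    simp only [m, zpow_zero, mul_one] at b1 b2 b3
    rw [abs_div, abs_of_pos (pow_pos hr 6)] at b2
    rw [abs_mul, abs_of_nonneg (a := 10 / _ + _) (by positivity)] at b3
    have e1 : |weight ε z * (S t z ^ 5 - R t z ^ 5) ^ 2 *
      energyCoeff μ (S t z ^ 5) (D₁ t z) (D₂ t z) (D₃ t z) (R t z ^ 5) (E₁ t z) (E₂ t z) (E₃ t z)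
        (18 / 5 * S t z ^ 13 * D₁ t z) (powQuotient (S t z) (R t z))| ≤
        weight ε z * (S t z ^ 5 - R t z ^ 5) ^ 2 * |C₁| := by
      rw [abs_mul, abs_of_nonneg (a := weight ε z * _) (by positivity)]
      exact mul_le_mul_of_nonneg_left (b1.trans (le_abs_self _)) (by positivity)
    have e2 : |weightD1 ε z / u₀ z * (S t z ^ 5 - R t z ^ 5) * weightCoeff μ (S t z ^ 5) (D₁ t z)
        (D₂ t z) (R t z ^ 5) (E₁ t z) (E₂ t z) (S t z ^ 18)| ≤
        weight ε z * (ε * |S t z ^ 5 - R t z ^ 5|) * |C₂| := by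
      rw [abs_mul, abs_mul]
      calc _ ≤ ε * weight ε z * (root u₀ z ^ 6)⁻¹ * |S t z ^ 5 - R t z ^ 5| *
            |weightCoeff μ (S t z ^ 5) (D₁ t z) (D₂ t z) (R t z ^ 5) (E₁ t z) (E₂ t z)
              (S t z ^ 18)| := by gcongr; exact hψ z hz
        _ = weight ε z * (ε * |S t z ^ 5 - R t z ^ 5|) * (|weightCoeff μ (S t z ^ 5) (D₁ t z)
              (D₂ t z) (R t z ^ 5) (E₁ t z) (E₂ t z) (S t z ^ 18)| / root u₀ z ^ 6) := by
            field_simp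
        _ ≤ _ := mul_le_mul_of_nonneg_left (b2.trans (le_abs_self _)) (by positivity)
    have e3 : |1 / 2 * ψ₁ z * (S t z ^ 5 - R t z ^ 5) * ((S t z ^ 5) ^ 6 * (D₁ t z - E₁ t z))| ≤
        weight ε z * (ε * |S t z ^ 5 - R t z ^ 5|) * |C₃| := by
      rw [abs_mul, abs_mul, abs_mul]
      calc _ ≤ 1 * (ε * weight ε z * (10 / root u₀ z ^ 12 +
            |6 / 5 * root u₀ z ^ 7 * D₁ 0 z| / root u₀ z ^ 18)) * |S t z ^ 5 - R t z ^ 5| *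
            |(S t z ^ 5) ^ 6 * (D₁ t z - E₁ t z)| := by
              gcongr
              · rw [abs_of_pos] <;> norm_num
              · exact hψ₁b z hz
        _ = weight ε z * (ε * |S t z ^ 5 - R t z ^ 5|) * ((10 / root u₀ z ^ 12 +
            |6 / 5 * root u₀ z ^ 7 * D₁ 0 z| / root u₀ z ^ 18) *
            |(S t z ^ 5) ^ 6 * (D₁ t z - E₁ t z)|) := by ring
        _ ≤ _ := mul_le_mul_of_nonneg_left (b3.trans (le_abs_self _)) (by positivity)
    have p1 : 0 ≤ weight ε z * (S t z ^ 5 - R t z ^ 5) ^ 2 * (|C₂| + |C₃|) := by positivity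
    have p2 : 0 ≤ weight ε z * (ε * |S t z ^ 5 - R t z ^ 5|) * |C₁| := by positivity
    calc |rem z| ≤ _ := (abs_sub _ _).trans (add_le_add_left (abs_sub _ _) _)
      _ ≤ _ := add_le_add (add_le_add e1 e2) e3
      _ ≤ _ := by rw [hC]; linarith
  have hGb : ∀ z, 0 < u₀ z → |G z| ≤ C' * weight ε z * u₀ z := by
    intro z hz
    have hr := root_pos hz
    have hw := weight_pos ε z
    have hp : (t, z) ∈ D := ⟨ht, hz⟩
    have b4 := hC₄ _ hp
    have b5 := hC₅ _ hp
    simp only [m] at b4 b5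
    rw [abs_div, abs_of_pos (pow_pos hr _), div_le_iff₀ (pow_pos hr _)] at b4 b5
    have b4' := b4.trans (mul_le_mul_of_nonneg_right (le_abs_self C₄) (pow_pos hr 6).le)
    have b5' := b5.trans (mul_le_mul_of_nonneg_right (le_abs_self C₅) (pow_pos hr 12).le)
    simp only [hG]
    refine (abs_add_le _ _).trans ?_
    rw [abs_mul, abs_of_pos hw, abs_mul, abs_mul, abs_of_pos (by norm_num : (0 : ℝ) < 1 / 2)]
    calc _ ≤ weight ε z * (|C₄| * root u₀ z ^ 6) + 1 * (1 * weight ε z * (root u₀ z ^ 6)⁻¹) *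
          (|C₅| * root u₀ z ^ 12) := by
          gcongr
          · norm_num
          · exact (hψ z hz).trans (by gcongr)
      _ = _ := by
          rw [hC', ← root_pow_six hz.le]
          field_simp
  have hC'0 : 0 ≤ C' := by positivity
  have hC0 : 0 ≤ C := by positivity
  classical
  -- The flux is continued by zero across vacuum, where the mass derivatives have no control.
  set F : ℝ → ℝ := fun z => if 0 < u₀ z then G z else 0 with hF
  have hFb : ∀ z, |F z| ≤ C' * weight ε z * u₀ z := by
    intro z
    by_cases hz : 0 < u₀ z
    · simp only [hF, if_pos hz]; exact hGb z hz
    · simp only [hF, if_neg hz, abs_zero]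
      have := hu₀ z
      have := weight_pos ε z
      positivity
  refine ⟨F, fun z => if 0 < u₀ z then u₀ z * (prod z - rem z) else 0, fun z => ?_, fun z => ?_,
    fun z => ?_⟩
  · by_cases hz : 0 < u₀ z
    · simp only [if_pos hz]
      refine (hGd z hz).congr_of_eventuallyEq ?_
      filter_upwards [hd.continuous.continuousAt.eventually_const_lt hz] with y hy
      simp only [hF, if_pos hy]
    · have hz0 : u₀ z = 0 := le_antisymm (not_lt.1 hz) (hu₀ z)
      simp only [if_neg hz]
      -- A zero of `u₀` is a minimum, so `u₀ = o(|y - z|)` there, and `F = O(u₀)` inherits a zero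
      -- derivative.
      have hmin : IsLocalMin u₀ z := Eventually.of_forall fun y => by rw [hz0]; exact hu₀ y
      have h0 : HasDerivAt u₀ 0 z := by
        have := (hd z).hasDerivAt
        rwa [hmin.deriv_eq_zero] at this
      rw [hasDerivAt_iff_isLittleO] at h0 ⊢
      have hFz : F z = 0 := by simp only [hF, if_neg hz]
      simp only [hFz, hz0, smul_zero, sub_zero] at h0 ⊢
      refine Asymptotics.IsBigO.trans_isLittleO ?_ h0
      refine Asymptotics.IsBigO.of_bound C' (Eventually.of_forall fun y => ?_)
      rw [Real.norm_eq_abs, Real.norm_eq_abs, abs_of_nonneg (hu₀ y)]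
      refine (hFb y).trans (mul_le_mul_of_nonneg_right ?_ (hu₀ y))
      exact mul_le_of_le_one_right hC'0 (weight_le_one ε y)
  · refine (hFb z).trans ?_
    have hw := weight_pos ε z
    calc C' * weight ε z * u₀ z ≤ C' * weight ε z * M := by gcongr; exact hM z
      _ ≤ _ := by nlinarith [mul_nonneg hC0 hw.le]
  · by_cases hz : 0 < u₀ z
    · simp only [if_pos hz]
      rw [show u₀ z * (prod z - rem z) - u₀ z * prod z = -(u₀ z * rem z) by ring, abs_neg, abs_mul,
        abs_of_pos hz, mul_left_comm]
      refine mul_le_mul_of_nonneg_left ((hremb z hz).trans ?_) hz.le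
      have hw := weight_pos ε z
      exact mul_le_mul_of_nonneg_right (le_add_of_nonneg_right (by positivity)) (by positivity)
    · have hz0 : u₀ z = 0 := le_antisymm (not_lt.1 hz) (hu₀ z)
      simp [hz0]

end Energy
-- Gronwall's inequality and vanishing of the energy
theorem le_of_deriv_le_mul_add {T K δ : ℝ} (hK : 0 ≤ K) (hδ : 0 ≤ δ) {E E' : ℝ → ℝ}
    (hc : ContinuousOn E (Icc 0 T)) (hd : ∀ t ∈ Ioo 0 T, HasDerivAt E (E' t) t)
    (h : ∀ t ∈ Ioo 0 T, E' t ≤ K * E t + δ) (h0 : E 0 = 0) {t : ℝ} (ht : t ∈ Icc 0 T) :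
    E t ≤ Real.exp (K * T) * (δ * T) := by
  have hanti : AntitoneOn (fun s => Real.exp (-(K * s)) * E s - δ * s) (Icc 0 T) := by
    refine antitoneOn_of_hasDerivWithinAt_nonpos (convex_Icc 0 T)
      (f' := fun s => Real.exp (-(K * s)) * -K * E s + Real.exp (-(K * s)) * E' s - δ) ?_ ?_ ?_
    · exact ((Continuous.continuousOn (by fun_prop)).mul hc).sub
        (Continuous.continuousOn (by fun_prop))
    · intro s hs
      rw [interior_Icc] at hs
      have h1 : HasDerivAt (fun s => -(K * s)) (-K) s :=
        ((hasDerivAt_id s).const_mul K).neg.congr_deriv (by ring)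
      exact ((h1.exp.mul (hd s hs)).sub
        (by simpa using (hasDerivAt_id s).const_mul δ)).hasDerivWithinAt
    · intro s hs
      rw [interior_Icc] at hs
      have h1 := h s hs
      have h2 : 0 < Real.exp (-(K * s)) := Real.exp_pos _
      have h3 : Real.exp (-(K * s)) ≤ 1 := Real.exp_le_one_iff.2 (by nlinarith [hs.1])
      nlinarith [mul_le_mul_of_nonneg_left h1 h2.le, mul_le_mul_of_nonneg_right h3 hδ]
  have h1 := hanti ⟨le_rfl, ht.1.trans ht.2⟩ ht ht.1
  simp only [h0, mul_zero, sub_zero] at h1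
  have h2 : E t = Real.exp (K * t) * (Real.exp (-(K * t)) * E t) := by
    rw [← mul_assoc, ← Real.exp_add]; simp
  rw [h2]
  have h3 : Real.exp (-(K * t)) * E t ≤ δ * T :=
    (by linarith : _ ≤ δ * t).trans (mul_le_mul_of_nonneg_left ht.2 hδ)
  have h4 : 0 ≤ δ * T := mul_nonneg hδ (ht.1.trans ht.2)
  calc _ ≤ Real.exp (K * t) * (δ * T) := by gcongr
    _ ≤ _ := by gcongr; exact ht.2

section Uniqueness

variable {μ T : ℝ} {u₀ : ℝ → ℝ} {S β D₁ D₂ D₃ R γ E₁ E₂ E₃ : ℝ → ℝ → ℝ}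

open MeasureTheory in
/-- The weighted energy of the difference of two solutions with the same initial data is of the
order of `ε`. -/
theorem exists_energy_le (hT : 0 < T) (hS : IsLagrangianSolution μ T u₀ S β D₁ D₂ D₃)
    (hR : IsLagrangianSolution μ T u₀ R γ E₁ E₂ E₃) (hu₀ : ∀ z, 0 ≤ u₀ z)
    (hd : Differentiable ℝ u₀) {M : ℝ} (hM : ∀ z, u₀ z ≤ M) :
    ∃ C, ∀ ε > 0, ε ≤ 1 → ∀ t ∈ Icc 0 T,
      Integrable (fun z => u₀ z * (weight ε z * (S t z ^ 5 - R t z ^ 5) ^ 2)) ∧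
      ∫ z, u₀ z * (weight ε z * (S t z ^ 5 - R t z ^ 5) ^ 2) ≤ C * ε := by
  obtain ⟨C, hC0, hC⟩ := exists_flux hT.le hS hR hu₀ hd hM
  obtain ⟨A, hA⟩ := hS.exists_bound_S hu₀ hM
  obtain ⟨B, hB⟩ := hR.exists_bound_S hu₀ hM
  obtain ⟨K, hK⟩ := hS.bounded_β
  obtain ⟨L, hL⟩ := hR.bounded_β
  have hM0 : 0 ≤ M := (hu₀ 0).trans (hM 0)
  have h0T : (0 : ℝ) ∈ Icc 0 T := ⟨le_rfl, hT.le⟩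
  have hA0 : 0 ≤ A := (abs_nonneg _).trans (hA 0 h0T 0)
  have hB0 : 0 ≤ B := (abs_nonneg _).trans (hB 0 h0T 0)
  have hK0 : 0 ≤ K := (abs_nonneg _).trans (hK 0 0)
  have hL0 : 0 ≤ L := (abs_nonneg _).trans (hL 0 0)
  obtain ⟨ω, hω⟩ : ∃ ω : ℝ → ℝ → ℝ, ω = fun t z => S t z ^ 5 - R t z ^ 5 := ⟨_, rfl⟩
  obtain ⟨N, hN⟩ : ∃ N : ℝ → ℝ → ℝ,
    N = fun t z => 5 / 6 * S t z ^ 5 * β t z - 5 / 6 * R t z ^ 5 * γ t z := ⟨_, rfl⟩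
  have hωc : Continuous fun p : ℝ × ℝ => ω p.1 p.2 := by
    rw [hω]; exact (hS.continuous_S.pow 5).sub (hR.continuous_S.pow 5)
  have hNc : Continuous fun p : ℝ × ℝ => N p.1 p.2 := by
    rw [hN]
    exact (((hS.continuous_S.pow 5).const_mul _).mul hS.continuous_β).sub
      (((hR.continuous_S.pow 5).const_mul _).mul hR.continuous_β)
  have hωz : ∀ t, Continuous (ω t) := fun t =>
    hωc.comp (f := fun z : ℝ => (t, z)) (by fun_prop)
  have hNz : ∀ t, Continuous (N t) := fun t =>
    hNc.comp (f := fun z : ℝ => (t, z)) (by fun_prop)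
  have hωt : ∀ z, Continuous fun t => ω t z := fun z =>
    hωc.comp (f := fun t : ℝ => (t, z)) (by fun_prop)
  have hωb : ∀ t ∈ Icc 0 T, ∀ z, |ω t z| ≤ A ^ 5 + B ^ 5 := by
    intro t ht z
    rw [hω]
    refine (abs_sub _ _).trans ?_
    rw [abs_pow, abs_pow]
    exact add_le_add (pow_le_pow_left₀ (abs_nonneg _) (hA t ht z) 5)
      (pow_le_pow_left₀ (abs_nonneg _) (hB t ht z) 5)
  have hNb : ∀ t ∈ Icc 0 T, ∀ z, |N t z| ≤ A ^ 5 * K + B ^ 5 * L := by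
    intro t ht z
    rw [hN]
    refine (abs_sub _ _).trans ?_
    rw [abs_mul, abs_mul (5 / 6 * R t z ^ 5), abs_mul, abs_mul (5 / 6), abs_pow, abs_pow,
      abs_of_pos (by norm_num : (0 : ℝ) < 5 / 6)]
    have h1 := mul_le_mul (pow_le_pow_left₀ (abs_nonneg _) (hA t ht z) 5) (hK t z) (abs_nonneg _)
      (by positivity)
    have h2 := mul_le_mul (pow_le_pow_left₀ (abs_nonneg _) (hB t ht z) 5) (hL t z) (abs_nonneg _)
      (by positivity)
    have h3 : 0 ≤ |S t z| ^ 5 * |β t z| := by positivity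
    have h4 : 0 ≤ |R t z| ^ 5 * |γ t z| := by positivity
    linarith
  set W := A ^ 5 + B ^ 5
  set W' := A ^ 5 * K + B ^ 5 * L
  have hW0 : 0 ≤ W := by positivity
  have hW'0 : 0 ≤ W' := by positivity
  have hωd : ∀ t ∈ Ioo 0 T, ∀ z, HasDerivAt (fun t => ω t z) (-N t z) t := by
    intro t ht z
    rw [hω, hN]
    exact ((hS.hasDerivAt_time t ht z).sub (hR.hasDerivAt_time t ht z)).congr_deriv (by ring)
  -- Gronwall constant for E' ≤ 4 C E + 2 C M π ε; the factor π ε is ε² times the integral π/ε of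
  -- the weight.
  refine ⟨Real.exp (4 * C * T) * (2 * C * M * Real.pi * T), fun ε hε hε1 => ?_⟩
  have hwi := integrable_weight hε
  have hwc := continuous_weight ε
  have huc := hd.continuous
  obtain ⟨e, he⟩ : ∃ e : ℝ → ℝ → ℝ, e = fun t z => u₀ z * (weight ε z * ω t z ^ 2) := ⟨_, rfl⟩
  obtain ⟨e', he'⟩ : ∃ e' : ℝ → ℝ → ℝ,
    e' = fun t z => -2 * (u₀ z * (weight ε z * ω t z * N t z)) := ⟨_, rfl⟩
  have hec : ∀ t, Continuous (e t) := fun t => by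
    rw [he]; exact huc.mul (hwc.mul ((hωz t).pow 2))
  have hec' : ∀ t, Continuous (e' t) := fun t => by
    rw [he']; exact (huc.mul ((hwc.mul (hωz t)).mul (hNz t))).const_mul _
  have heb : ∀ t ∈ Icc 0 T, ∀ z, ‖e t z‖ ≤ M * W ^ 2 * weight ε z := by
    intro t ht z
    have hw := weight_pos ε z
    rw [he, Real.norm_eq_abs, abs_mul, abs_mul, abs_of_nonneg (hu₀ z), abs_of_pos hw, abs_pow]
    calc _ ≤ M * (weight ε z * W ^ 2) := by gcongr; exacts [hM z, hωb t ht z]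
      _ = _ := by ring
  have heb' : ∀ t ∈ Icc 0 T, ∀ z, ‖e' t z‖ ≤ 2 * (M * (W * W')) * weight ε z := by
    intro t ht z
    have hw := weight_pos ε z
    rw [he', Real.norm_eq_abs, abs_mul, abs_mul, abs_mul, abs_mul, abs_of_nonneg (hu₀ z),
      abs_of_pos hw, abs_neg, abs_of_pos (by norm_num : (0 : ℝ) < 2)]
    calc _ ≤ 2 * (M * (weight ε z * W * W')) := by
          gcongr
          exacts [hM z, hωb t ht z, hNb t ht z]
      _ = _ := by ring
  have hei : ∀ t ∈ Icc 0 T, Integrable (e t) := fun t ht =>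
    (hwi.const_mul (M * W ^ 2)).mono' (hec t).aestronglyMeasurable
      (Eventually.of_forall (heb t ht))
  have hei' : ∀ t ∈ Icc 0 T, Integrable (e' t) := fun t ht =>
    (hwi.const_mul (2 * (M * (W * W')))).mono' (hec' t).aestronglyMeasurable
      (Eventually.of_forall (heb' t ht))
  have hEc : ContinuousOn (fun t => ∫ z, e t z) (Icc 0 T) := by
    refine continuousOn_of_dominated (bound := fun z => M * W ^ 2 * weight ε z)
      (fun t _ => (hec t).aestronglyMeasurable)
      (fun t ht => Eventually.of_forall (heb t ht)) (hwi.const_mul _)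
      (Eventually.of_forall fun z => Continuous.continuousOn ?_)
    rw [he]
    exact (((hωt z).pow 2).const_mul _).const_mul _
  have hEd : ∀ t ∈ Ioo 0 T, HasDerivAt (fun t => ∫ z, e t z) (∫ z, e' t z) t := by
    intro t ht
    refine (hasDerivAt_integral_of_dominated_loc_of_deriv_le
      (bound := fun z => 2 * (M * (W * W')) * weight ε z) (Ioo_mem_nhds ht.1 ht.2)
      (Eventually.of_forall fun s => (hec s).aestronglyMeasurable) (hei t ⟨ht.1.le, ht.2.le⟩)
      (hec' t).aestronglyMeasurable
      (Eventually.of_forall fun z s hs => heb' s ⟨hs.1.le, hs.2.le⟩ z) (hwi.const_mul _)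
      (Eventually.of_forall fun z s hs => ?_)).2
    rw [he, he']
    refine ((((hωd s hs z).pow 2).const_mul (weight ε z)).const_mul (u₀ z)).congr_deriv ?_
    push_cast
    ring
  have hEle : ∀ t ∈ Ioo 0 T, ∫ z, e' t z ≤
      4 * C * (∫ z, e t z) + 2 * C * M * Real.pi * ε := by
    intro t ht
    have ht' : t ∈ Icc 0 T := ⟨ht.1.le, ht.2.le⟩
    obtain ⟨F, F', hFd, hFb, hFF⟩ := hC ε hε hε1 t ht'
    have hFi : Integrable F := (hwi.const_mul C).mono'
      (continuous_iff_continuousAt.2 fun z => (hFd z).continuousAt).aestronglyMeasurable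
      (Eventually.of_forall hFb)
    have hF'eq : F' = deriv F := funext fun z => (hFd z).deriv.symm
    -- Here `-(1/2) e'` is the energy production density, which `F'` matches up to the error of
    -- `exists_flux`; that error is split by ε |ω| ≤ ω² + ε².
    have hkey : ∀ z, |F' z - -(1 / 2) * e' t z| ≤ 2 * C * e t z + C * M * ε ^ 2 * weight ε z := by
      intro z
      have h1 := hFF z
      have hw := weight_pos ε z
      have h2 : ω t z = S t z ^ 5 - R t z ^ 5 := by rw [hω]
      have h3 : N t z = 5 / 6 * S t z ^ 5 * β t z - 5 / 6 * R t z ^ 5 * γ t z := by rw [hN]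
      rw [← h2, ← h3] at h1
      rw [he', he]
      rw [show -(1 / 2) * (-2 * (u₀ z * (weight ε z * ω t z * N t z))) =
        u₀ z * (weight ε z * ω t z * N t z) by ring]
      refine h1.trans ?_
      have h4 : ε * |ω t z| ≤ ω t z ^ 2 + ε ^ 2 := by
        rw [← sq_abs (ω t z)]
        nlinarith [sq_nonneg (|ω t z| - ε), sq_nonneg (|ω t z|), sq_nonneg ε]
      have hu := hu₀ z
      calc _ ≤ C * (u₀ z * (weight ε z * (ω t z ^ 2 + (ω t z ^ 2 + ε ^ 2)))) := by gcongr
        _ = 2 * C * (u₀ z * (weight ε z * ω t z ^ 2)) + C * u₀ z * ε ^ 2 * weight ε z := by ring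
        _ ≤ _ := by gcongr; exact hM z
    have hbi : Integrable fun z => 2 * C * e t z + C * M * ε ^ 2 * weight ε z :=
      ((hei t ht').const_mul _).add (hwi.const_mul _)
    -- `F'` has no direct bound; it is integrable because it is close to the integrable production
    -- density.
    have hF'i : Integrable F' := by
      have h1 : Integrable fun z => F' z - -(1 / 2) * e' t z := by
        refine hbi.mono' (AEStronglyMeasurable.sub ?_
          ((hec' t).const_mul _).aestronglyMeasurable) (Eventually.of_forall hkey)
        rw [hF'eq]
        exact (stronglyMeasurable_deriv F).aestronglyMeasurable
      exact (h1.add ((hei' t ht').const_mul (-(1 / 2)))).congr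
        (Eventually.of_forall fun z => by simp)
    have hF0 : ∫ z, F' z = 0 := integral_eq_zero_of_hasDerivAt_of_integrable hFd hF'i hFi
    have hmono : ∫ z, e' t z ≤
        ∫ z, (2 * (2 * C * e t z + C * M * ε ^ 2 * weight ε z) - 2 * F' z) := by
      refine integral_mono (hei' t ht') ((hbi.const_mul 2).sub (hF'i.const_mul 2)) fun z => ?_
      have := (abs_le.1 (hkey z)).2
      simp only
      linarith
    rw [integral_sub (hbi.const_mul 2) (hF'i.const_mul 2), integral_const_mul, integral_const_mul,
      hF0, integral_add ((hei t ht').const_mul _) (hwi.const_mul _), integral_const_mul,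
      integral_const_mul, integral_weight hε] at hmono
    refine hmono.trans (le_of_eq ?_)
    field_simp
    ring
  intro t ht
  have hE0 : ∫ z, e 0 z = 0 := by
    have : e 0 = fun _ => 0 := by
      funext z
      simp [he, hω, hS.initial, hR.initial]
    rw [this, integral_zero]
  have hpi := Real.pi_pos
  have := le_of_deriv_le_mul_add (K := 4 * C) (δ := 2 * C * M * Real.pi * ε) (by positivity)
    (by positivity) hEc hEd hEle hE0 ht
  have heq : (fun z => u₀ z * (weight ε z * (S t z ^ 5 - R t z ^ 5) ^ 2)) = e t := by
    rw [he, hω]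
  refine ⟨heq ▸ hei t ht, ?_⟩
  rw [heq]
  refine this.trans (le_of_eq ?_)
  ring

open MeasureTheory in
-- The weight with parameter 1 lies below every weight with `ε ≤ 1`, so the fixed energy at
-- parameter 1 is at most `C ε` for all such `ε` and vanishes. Equality over vacuum labels is
-- separate: both functions are zero there.
theorem IsLagrangianSolution.unique (hT : 0 < T) (hS : IsLagrangianSolution μ T u₀ S β D₁ D₂ D₃)
    (hR : IsLagrangianSolution μ T u₀ R γ E₁ E₂ E₃) (hu₀ : ∀ z, 0 ≤ u₀ z)
    (hd : Differentiable ℝ u₀) {M : ℝ} (hM : ∀ z, u₀ z ≤ M) {t : ℝ} (ht : t ∈ Icc 0 T) (z : ℝ) :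
    S t z = R t z := by
  obtain ⟨C, hC⟩ := exists_energy_le hT hS hR hu₀ hd hM
  set j : ℝ → ℝ := fun z => u₀ z * (weight 1 z * (S t z ^ 5 - R t z ^ 5) ^ 2) with hj
  have hj0 : ∀ z, 0 ≤ j z := fun z =>
    mul_nonneg (hu₀ z) (mul_nonneg (weight_pos 1 z).le (sq_nonneg _))
  have hji : Integrable j := (hC 1 one_pos le_rfl t ht).1
  have hle : ∀ ε > 0, ε ≤ 1 → ∫ z, j z ≤ C * ε := by
    intro ε hε hε1
    obtain ⟨h1, h2⟩ := hC ε hε hε1 t ht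
    refine (integral_mono hji h1 fun z => ?_).trans h2
    refine mul_le_mul_of_nonneg_left (mul_le_mul_of_nonneg_right ?_ (sq_nonneg _)) (hu₀ z)
    unfold weight
    rw [mul_pow, mul_pow]
    gcongr
  have hint : ∫ z, j z = 0 := by
    refine le_antisymm ?_ (integral_nonneg hj0)
    have hlim : Tendsto (fun ε : ℝ => C * ε) (𝓝[>] 0) (𝓝 0) := by
      have : Tendsto (fun ε : ℝ => C * ε) (𝓝 0) (𝓝 (C * 0)) := tendsto_id.const_mul C
      rw [mul_zero] at this
      exact this.mono_left nhdsWithin_le_nhds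
    refine ge_of_tendsto hlim ?_
    filter_upwards [Ioc_mem_nhdsGT (zero_lt_one' ℝ)] with ε hε using hle ε hε.1 hε.2
  have hjc : Continuous j := by
    have hz : Continuous fun z : ℝ => (t, z) := by fun_prop
    exact hd.continuous.mul ((continuous_weight 1).mul
      ((((hS.continuous_S.comp hz).pow 5).sub ((hR.continuous_S.comp hz).pow 5)).pow 2))
  have hjz : j = fun _ => 0 := by
    have := (integral_eq_zero_iff_of_nonneg hj0 hji).1 hint
    exact (hjc.ae_eq_iff_eq volume continuous_const).1 this
  have hz := congrFun hjz z
  rcases (hu₀ z).eq_or_lt with h0 | h0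
  · rw [hS.S_eq_zero hu₀ ht h0.symm, hR.S_eq_zero hu₀ ht h0.symm]
  · have hw := weight_pos 1 z
    simp only [hj, mul_eq_zero, h0.ne', hw.ne', false_or] at hz
    have h5 : S t z ^ 5 = R t z ^ 5 := by
      have := pow_eq_zero_iff (two_ne_zero) |>.1 hz
      linarith
    exact (pow_left_inj₀ (hS.S_nonneg hu₀ ht z) (hR.S_nonneg hu₀ ht z) (by norm_num)).1 h5

end Uniqueness

/-! ### Return to the original variables -/

theorem theorem1p4 (μ : ℝ) (hμ : μ = 1 ∨ μ = -1 ∨ μ = 0) (T : ℝ) (hT : 0 < T)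
    (u₀ : ℝ → ℝ) (hu₀_nonneg : ∀ x, 0 ≤ u₀ x) (hu₀ : MemCb 1 u₀)
    (hu₀_sq : MemCb 3 (fun x => u₀ x ^ 2))
    (hu₀_pow : MemCb 2 (fun x => u₀ x ^ ((4 : ℝ) / 3)))
    (u v : ℝ → ℝ → ℝ)
    (hu : IsHydrodynamicSolution μ T u₀ u)
    (hu_sq : ContInTimeCb T 3 (fun t x => u t x ^ 2))
    (hu_pow : ContInTimeCb T 2 (fun t x => u t x ^ ((4 : ℝ) / 3)))
    (hv : IsHydrodynamicSolution μ T u₀ v)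
    (hv_sq : ContInTimeCb T 3 (fun t x => v t x ^ 2))
    (hv_pow : ContInTimeCb T 2 (fun t x => v t x ^ ((4 : ℝ) / 3))) :
    ∀ t ∈ Icc 0 T, ∀ x, u t x = v t x := by
  obtain ⟨X, S, β, D₁, D₂, D₃, hS, hXc, hX0, hXs, huS, hXd⟩ :=
    exists_lagrangianSolution hT hu hu_sq hu_pow
  obtain ⟨Y, R, γ, E₁, E₂, E₃, hR, hYc, hY0, hYs, hvR, hYd⟩ :=
    exists_lagrangianSolution hT hv hv_sq hv_pow
  have hd : Differentiable ℝ u₀ := hu₀.1.differentiable (by norm_num)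
  obtain ⟨M, hM⟩ := hu₀.2 0 (by norm_num)
  have hM' : ∀ z, u₀ z ≤ M := fun z => by simpa using (abs_le.1 (hM z)).2
  have hSR : ∀ t ∈ Icc 0 T, S t = R t := fun t ht => funext fun z =>
    hS.unique hT hR hu₀_nonneg hd hM' ht z
  have h1 : ∀ t ∈ Icc 0 T, ∀ z, 0 < u₀ z → D₁ t z = E₁ t z := by
    intro t ht z hz
    have a := hS.hasDerivAt_pow ht hz
    have b := hR.hasDerivAt_pow ht hz
    rw [← hSR t ht] at b
    exact mul_left_cancel₀ hz.ne' (a.unique b)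
  have h2 : ∀ t ∈ Icc 0 T, ∀ z, 0 < u₀ z → D₂ t z = E₂ t z := by
    intro t ht z hz
    have a := hS.hasDerivAt_D₁ t ht z hz
    have b := (hR.hasDerivAt_D₁ t ht z hz).congr_of_eventuallyEq (f₁ := D₁ t) (by
      filter_upwards [hd.continuous.continuousAt.eventually_const_lt hz] with y hy using h1 t ht y hy)
    exact mul_left_cancel₀ hz.ne' (a.unique b)
  -- Over positive labels the velocity is a function of `S`, `D₁`, `D₂` alone, so both trajectories
  -- have the same derivative in time.
  have hXY : ∀ t ∈ Icc 0 T, ∀ z, 0 < u₀ z → X t z = Y t z := by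
    intro t ht z hz
    have hz' : Continuous fun s : ℝ => (s, z) := by fun_prop
    have := eq_of_hasDerivAt_zero (f := fun s => X s z - Y s z)
      ((hXc.comp hz').sub (hYc.comp hz')).continuousOn (fun s hs => by
        have hs' : s ∈ Icc 0 T := ⟨hs.1.le, hs.2.le⟩
        refine ((hXd s hs z hz).sub (hYd s hs z hz)).congr_deriv ?_
        rw [hSR s hs', h1 s hs' z hz, h2 s hs' z hz]
        ring) ht
    simp only [hX0, hY0, sub_self] at this
    linarith
  intro t ht x
  obtain ⟨z, rfl⟩ := hXs t ht x
  rcases (hu₀_nonneg z).eq_or_lt with h0 | h0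
  -- The flows are not compared over vacuum labels. Instead the same point is labelled by `Y`: if
  -- that label carries mass, `X` and `Y` agree on it; otherwise both solutions vanish at the point.
  · obtain ⟨z', hz'⟩ := hYs t ht (X t z)
    have hu0 : u t (X t z) = 0 := by
      rw [huS t ht, hS.S_eq_zero hu₀_nonneg ht h0.symm]; norm_num
    rcases (hu₀_nonneg z').eq_or_lt with h0' | h0'
    · rw [hu0, ← hz', hvR t ht, hR.S_eq_zero hu₀_nonneg ht h0'.symm]; norm_num
    · rw [← hz', ← hXY t ht z' h0', huS t ht, hXY t ht z' h0', hvR t ht, hSR t ht]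
  · rw [huS t ht, hXY t ht z h0, hvR t ht, hSR t ht]
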